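/- All graphs are finite and loopless; multiple edges are allowed. Let $m\ge 1$ be an integer. A graph is called *$m$-tree-connected* if it has $m$ pairwise edge-disjoint spanning trees (a spanning tree has at least one vertex, so the graph with no vertices is not $m$-tree-connected). The *$m$-tree-connected components* of a graph $G$ are its maximal induced $m$-tree-connected subgraphs; their vertex sets form a partition $P$ of $V(G)$, and one puts $$\Omega_m(G)=|P|-\frac1m\,e_G(P),$$ where $e_G(P)$ is the number of edges of $G$ whose ends lie in different parts of $P$ (so $\Omega_m=0$ for the graph with no vertices). For $S\subseteq V(G)$, let $G\setminus S$ be the graph obtained from $G$ by deleting the vertices of $S$, and let $e_G(S)$ be the number of edges of $G$ with both ends in $S$. Let $d_H(v)$ denote the degree of $v$ in $H$. **Theorem.** Let $G$ be an $m$-tree-connected graph and let $X\subseteq V(G)$. Let $\lambda\in[0,1/m]$ be a real number and let $\eta:X\to\bigl(m\lambda+\frac{m-1}{m},\,\infty\bigr)$ be a real function. Suppose that for all $S\subseteq X$, $$\Omega_m(G\setminus S)<\frac1m+\sum_{v\in S}\bigl(\eta(v)-2\bigr)+2-\lambda\bigl(e_G(S)+m\bigr).$$ Then $G$ has an $m$-tree-connected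 spanning subgraph $H$ such that for every $v\in X$, $$d_H(v)\le\bigl\lceil m\eta(v)-m^2\lambda\bigr\rceil.$$ -/

import Mathlib

open scoped Graph

noncomputable section

namespace Graph

variable {α β : Type*}

/-- `G` is connected: it has a vertex, and any two vertices are joined by a walk. -/
def IsConnected (G : Graph α β) : Prop :=
  V(G).Nonempty ∧ ∀ x ∈ V(G), ∀ y ∈ V(G), Relation.ReflTransGen G.Adj x y

/-- `v 0, e 0, v 1, e 1, …, v n, e n, v 0` is a cycle of `G` with `n + 1` distinct vertices and
`n + 1` distinct edges (addition in `Fin (n + 1)` is cyclic; `n = 0` is a loop, `n = 1` a pair of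
parallel edges). -/
def IsCycle (G : Graph α β) (n : ℕ) (v : Fin (n + 1) → α) (e : Fin (n + 1) → β) : Prop :=
  Function.Injective v ∧ Function.Injective e ∧ ∀ i, G.IsLink (e i) (v i) (v (i + 1))

/-- A tree is a connected graph without cycles. -/
def IsTree (G : Graph α β) : Prop :=
  G.IsConnected ∧ ∀ (n : ℕ) (v : Fin (n + 1) → α) (e : Fin (n + 1) → β), ¬ G.IsCycle n v e

/-- `G` is `m`-tree-connected: it has `m` pairwise edge-disjoint spanning trees. -/
def IsTreeConnected (G : Graph α β) (m : ℕ) : Prop :=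
  ∃ T : Fin m → Graph α β,
    (∀ i, (T i).IsSpanningSubgraph G ∧ (T i).IsTree) ∧
    ∀ i j, i ≠ j → Disjoint E(T i) E(T j)

/-- The vertex sets of the `m`-tree-connected components of `G`, that is, of the maximal induced
`m`-tree-connected subgraphs of `G`. -/
def treeComponents (G : Graph α β) (m : ℕ) : Set (Set α) :=
  {C | Maximal (fun D : Set α => D ⊆ V(G) ∧ (G.induce D).IsTreeConnected m) C}

/-- `e_G(P)`: the number of edges of `G` whose ends lie in different members of `P`. -/
def numCrossing (G : Graph α β) (P : Set (Set α)) : ℕ :=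
  {e : β | ∃ x y, G.IsLink e x y ∧ ∃ A ∈ P, ∃ B ∈ P, A ≠ B ∧ x ∈ A ∧ y ∈ B}.ncard

/-- `Ω_m(G) = |P| - e_G(P) / m`, where `P` is the partition of `V(G)` into the vertex sets of the
`m`-tree-connected components of `G`. -/
def Omega (m : ℕ) (G : Graph α β) : ℝ :=
  ((G.treeComponents m).ncard : ℝ) - (1 / (m : ℝ)) * (G.numCrossing (G.treeComponents m) : ℝ)

/-- `e_G(S)`: the number of edges of `G` with both ends in `S`. -/
def numInside (G : Graph α β) (S : Set α) : ℕ :=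
  {e : β | ∃ x y, G.IsLink e x y ∧ x ∈ S ∧ y ∈ S}.ncard

/-- The degree of `v` in a loopless graph: the number of edges incident with `v`. -/
def degree (G : Graph α β) (v : α) : ℕ :=
  (G.incidenceSet v).ncard

end Graph

end

/-!
By matroid partition, applied to the incidence vectors of the edges, an edge set is a union of `m`
forests if and only if every nonempty vertex set `W` spans at most `m (|W| - 1)` of its edges
(Nash-Williams). So the edge sets of minimally `m`-tree-connected spanning subgraphs are the bases,
the sparse sets `H` of `m (|V| - 1)` edges, and a vertex set attaining the bound is tight; tight
sets lie inside `m`-tree-connected components.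

Take a base `H` whose degrees exceed the prescribed bound `h` as little as possible in total. If
`H` violates the bound somewhere, consider the vertices whose degree cannot be brought below the
bound by rearranging `H` inside a tight set, at first an arbitrary one, then one avoiding the
vertices already found, and so on. This stabilises at a set `S` on which all degrees are at least
`h`, with strict inequality somewhere. An edge outside `H` that avoids `S` lies in a tight set
avoiding `S`, for otherwise both of its ends could be given room, the edge inserted, and an edge at
a vertex of `S` removed in exchange. Hence every component of `G \ S` is spanned by `H`, and every
edge between different components belongs to `H`. Counting the edges of `H` gives
`∑_{v ∈ S} d_H(v) ≤ m Ω_m(G \ S) + m (|S| - 1) + e_H(S)`.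

Finally `e_H(S)` is at most both `e_G(S)` and `m (|S| - 1)`, hence at most their convex combination
with weights `m λ` and `1 - m λ`, and this contradicts the hypothesis on `S`.
-/

section MatroidPartition

variable {K M β ι : Type*} [DivisionRing K] [AddCommGroup M] [Module K M] {v : β → M}

theorem mem_span_image_inter_of_exchangeable {I A : Set β} {e : β} (hI : LinearIndepOn K v I)
    (he : v e ∈ Submodule.span K (v '' I))
    (hA : ∀ f ∈ I, LinearIndepOn K v (insert e (I \ {f})) → f ∈ A) :
    v e ∈ Submodule.span K (v '' (A ∩ I)) := by
  obtain ⟨l, hlI, hl⟩ := (Finsupp.mem_span_image_iff_linearCombination K).1 he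
  refine (Finsupp.mem_span_image_iff_linearCombination K).2 ⟨l, fun f hf => ⟨?_, hlI hf⟩, hl⟩
  refine hA f (hlI hf) ((hI.mono Set.sdiff_subset).insert fun hspan => ?_)
  obtain ⟨l', hlI', hl'⟩ := (Finsupp.mem_span_image_iff_linearCombination K).1 hspan
  have hll' : l = l' := sub_eq_zero.1 <| linearIndepOn_iff.1 hI (l - l')
    (sub_mem hlI (Finsupp.supported_mono Set.sdiff_subset hlI'))
    (by rw [map_sub, hl, hl', sub_self])
  exact (hlI' (hll' ▸ hf)).2 rfl

/-- The class of colour `i` of the colouring `c`, restricted to the elements of `F`. -/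
def colorClass (c : β → ι) (F : Set β) (i : ι) : Set β :=
  {f | f ∈ F ∧ c f = i}

theorem colorClass_mono {c : β → ι} {F F' : Set β} (h : F ⊆ F') (i : ι) :
    colorClass c F i ⊆ colorClass c F' i :=
  fun _ hf => ⟨h hf.1, hf.2⟩

theorem colorClass_sdiff_singleton (c : β → ι) (F : Set β) (f : β) (i : ι) :
    colorClass c (F \ {f}) i = colorClass c F i \ {f} := by
  ext g
  simp only [colorClass, Set.mem_sdiff, Set.mem_ofPred_eq]
  tauto

theorem colorClass_update_self [DecidableEq β] {c : β → ι} {F : Set β} {e : β} (he : e ∈ F)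
    (i : ι) :
    colorClass (Function.update c e i) F i = insert e (colorClass c (F \ {e}) i) := by
  ext g
  by_cases hg : g = e <;> simp [colorClass, hg, he]

theorem colorClass_update_of_ne [DecidableEq β] {c : β → ι} {F : Set β} {e : β} {i j : ι}
    (hj : j ≠ i) :
    colorClass (Function.update c e i) F j = colorClass c (F \ {e}) j := by
  ext g
  by_cases hg : g = e <;> simp [colorClass, hg, hj.symm]

variable (K v) in
/-- The colouring `c` partitions `F` into linearly independent classes. A partial colouring with
one uncoloured element `e` is encoded as a colouring of `F \ {e}`. -/
def IsIndepColoring (F : Set β) (c : β → ι) : Prop :=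
  ∀ i, LinearIndepOn K v (colorClass c F i)

theorem IsIndepColoring.mono {F F' : Set β} {c : β → ι} (hc : IsIndepColoring K v F' c)
    (h : F ⊆ F') : IsIndepColoring K v F c :=
  fun i => (hc i).mono (colorClass_mono h i)

theorem IsIndepColoring.update [DecidableEq β] {F : Set β} {c : β → ι} {e : β} {i : ι}
    (hc : IsIndepColoring K v (F \ {e}) c) (he : e ∈ F)
    (hi : LinearIndepOn K v (insert e (colorClass c (F \ {e}) i))) :
    IsIndepColoring K v F (Function.update c e i) := by
  intro j
  obtain rfl | hj := eq_or_ne j i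
  · rwa [colorClass_update_self he]
  · rw [colorClass_update_of_ne hj]
    exact hc j

variable (K v) in
/-- One exchange step between independent colourings of `F` with one uncoloured element, written
as pairs of the uncoloured element and the colouring: the uncoloured element of `p` receives the
colour of the uncoloured element of `q`. -/
def ExchangeStep [DecidableEq β] (F : Set β) (p q : β × (β → ι)) : Prop :=
  q.1 ∈ F \ {p.1} ∧ q.2 = Function.update p.2 p.1 (p.2 q.1) ∧
    IsIndepColoring K v (F \ {q.1}) q.2

theorem IsIndepColoring.exchangeStep [DecidableEq β] {F : Set β} {c : β → ι} {e f : β}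
    (hc : IsIndepColoring K v (F \ {e}) c) (he : e ∈ F) (hf : f ∈ F \ {e})
    (hind : LinearIndepOn K v (insert e (colorClass c (F \ {e}) (c f) \ {f}))) :
    ExchangeStep K v F (e, c) (f, Function.update c e (c f)) := by
  refine ⟨hf, rfl, IsIndepColoring.update ?_ ⟨he, Ne.symm hf.2⟩ ?_⟩
  · exact hc.mono (Set.sdiff_subset_sdiff_left Set.sdiff_subset)
  · rwa [sdiff_right_comm, colorClass_sdiff_singleton]

theorem IsIndepColoring.mem_span_of_forall_exchangeStep [DecidableEq β] {F A : Set β} {c : β → ι}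
    {e : β} (hc : IsIndepColoring K v (F \ {e}) c) (he : e ∈ F)
    (hF : ¬ ∃ d : β → ι, IsIndepColoring K v F d)
    (hA : ∀ q, ExchangeStep K v F (e, c) q → q.1 ∈ A) (i : ι) :
    v e ∈ Submodule.span K (v '' (A ∩ colorClass c (F \ {e}) i)) := by
  refine mem_span_image_inter_of_exchangeable (hc i) ?_ ?_
  · by_contra hspan
    exact hF ⟨_, hc.update he ((hc i).insert hspan)⟩
  · rintro f ⟨hf, rfl⟩ hind
    exact hA _ (hc.exchangeStep he hf hind)

theorem ExchangeStep.span_le [DecidableEq β] {F A : Set β} {p q : β × (β → ι)}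
    (h : ExchangeStep K v F p q) (hp : p.1 ∈ F)
    (hspan : ∀ i, v p.1 ∈ Submodule.span K (v '' (A ∩ colorClass p.2 (F \ {p.1}) i))) (i : ι) :
    Submodule.span K (v '' (A ∩ colorClass q.2 (F \ {q.1}) i)) ≤
      Submodule.span K (v '' (A ∩ colorClass p.2 (F \ {p.1}) i)) := by
  obtain ⟨⟨-, hqp⟩, hq, -⟩ := h
  have hsub : (F \ {q.1}) \ {p.1} ⊆ F \ {p.1} := Set.sdiff_subset_sdiff_left Set.sdiff_subset
  rw [hq, Submodule.span_le]
  rintro _ ⟨g, ⟨hgA, hg⟩, rfl⟩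
  obtain rfl | hi := eq_or_ne i (p.2 q.1)
  · rw [colorClass_update_self (F := F \ {q.1}) ⟨hp, Ne.symm hqp⟩] at hg
    obtain rfl | hg := hg
    · exact hspan _
    · exact Submodule.subset_span ⟨g, ⟨hgA, colorClass_mono hsub _ hg⟩, rfl⟩
  · rw [colorClass_update_of_ne hi] at hg
    exact Submodule.subset_span ⟨g, ⟨hgA, colorClass_mono hsub _ hg⟩, rfl⟩

/-- The matroid partition theorem for vector families, in the form of one augmentation. -/
theorem IsIndepColoring.exists_extension_or_obstruction {F : Set β} {c : β → ι} {e : β}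
    (hc : IsIndepColoring K v (F \ {e}) c) (he : e ∈ F) :
    (∃ d : β → ι, IsIndepColoring K v F d) ∨
      ∃ A ⊆ F, e ∈ A ∧
        ∀ i, ∀ f ∈ A, v f ∈ Submodule.span K (v '' (A ∩ colorClass c (F \ {e}) i)) := by
  classical
  refine or_iff_not_imp_left.2 fun hF => ?_
  let Reachable := Relation.ReflTransGen (ExchangeStep K v F) (e, c)
  let A : Set β := {f | ∃ d, Reachable (f, d)}
  have valid : ∀ p, Reachable p → p.1 ∈ F ∧ IsIndepColoring K v (F \ {p.1}) p.2 := by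
    intro p hp
    cases hp with
    | refl => exact ⟨he, hc⟩
    | tail _ h => exact ⟨h.1.1, h.2.2⟩
  have uncolored : ∀ p, Reachable p → ∀ i,
      v p.1 ∈ Submodule.span K (v '' (A ∩ colorClass p.2 (F \ {p.1}) i)) := fun p hp =>
    (valid p hp).2.mem_span_of_forall_exchangeStep (valid p hp).1 hF
      fun q hq => ⟨q.2, hp.tail hq⟩
  have span_le : ∀ p, Reachable p → ∀ i,
      Submodule.span K (v '' (A ∩ colorClass p.2 (F \ {p.1}) i)) ≤
        Submodule.span K (v '' (A ∩ colorClass c (F \ {e}) i)) := by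
    intro p hp
    induction hp with
    | refl => exact fun i => le_rfl
    | tail hp h ih => exact fun i => (h.span_le (valid _ hp).1 (uncolored _ hp) i).trans (ih i)
  refine ⟨A, fun f ⟨d, hd⟩ => (valid _ hd).1, ⟨c, .refl⟩, ?_⟩
  rintro i f ⟨d, hd⟩
  exact span_le _ hd i (uncolored _ hd i)

end MatroidPartition

section EdgeVectors

variable {α β : Type*} {s t : β → α}

/-- Adjacency by an edge in `F`, where the edge `e` has the ends `s e` and `t e`. -/
def LinkedBy (s t : β → α) (F : Set β) (x y : α) : Prop :=
  ∃ e ∈ F, (s e = x ∧ t e = y) ∨ (s e = y ∧ t e = x)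

/-- The vertices `x` and `y` are joined by a walk with edges in `F`. -/
def EdgeJoined (s t : β → α) (F : Set β) : α → α → Prop :=
  Relation.ReflTransGen (LinkedBy s t F)

theorem LinkedBy.symm {F : Set β} {x y : α} (h : LinkedBy s t F x y) : LinkedBy s t F y x := by
  obtain ⟨e, he, h⟩ := h
  exact ⟨e, he, h.symm⟩

theorem EdgeJoined.symm {F : Set β} {x y : α} (h : EdgeJoined s t F x y) :
    EdgeJoined s t F y x := by
  have : Std.Symm (LinkedBy s t F) := ⟨fun _ _ => LinkedBy.symm⟩
  exact Relation.ReflTransGen.stdSymm.symm _ _ h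

theorem EdgeJoined.of_mem {F : Set β} {e : β} (he : e ∈ F) : EdgeJoined s t F (s e) (t e) :=
  .single ⟨e, he, Or.inl ⟨rfl, rfl⟩⟩

theorem EdgeJoined.of_forall {F F' : Set β} {x y : α} (h : EdgeJoined s t F x y)
    (hF : ∀ e ∈ F, EdgeJoined s t F' (s e) (t e)) : EdgeJoined s t F' x y := by
  induction h with
  | refl => exact .refl
  | tail _ h ih =>
    obtain ⟨e, he, ⟨rfl, rfl⟩ | ⟨rfl, rfl⟩⟩ := h
    · exact ih.trans (hF e he)
    · exact ih.trans (hF e he).symm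

/-- The edges with both ends in `D`. -/
def endsIn (s t : β → α) (D : Set α) : Set β :=
  {e | s e ∈ D ∧ t e ∈ D}

theorem EdgeJoined.mono {F F' : Set β} {x y : α} (h : EdgeJoined s t F x y) (hF : F ⊆ F') :
    EdgeJoined s t F' x y :=
  h.of_forall fun _ he => .of_mem (hF he)

theorem EdgeJoined.inter_of_closed {F : Set β} {U : Set α} {x y : α} (h : EdgeJoined s t F x y)
    (hx : x ∈ U) (hU : ∀ e ∈ F, s e ∈ U ↔ t e ∈ U) :
    EdgeJoined s t (F ∩ endsIn s t U) x y := by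
  suffices y ∈ U ∧ EdgeJoined s t (F ∩ endsIn s t U) x y from this.2
  induction h with
  | refl => exact ⟨hx, .refl⟩
  | tail _ h ih =>
    obtain ⟨hb, hj⟩ := ih
    obtain ⟨e, he, ⟨rfl, rfl⟩ | ⟨rfl, rfl⟩⟩ := h
    · exact ⟨(hU e he).1 hb, hj.tail ⟨e, ⟨he, hb, (hU e he).1 hb⟩, Or.inl ⟨rfl, rfl⟩⟩⟩
    · exact ⟨(hU e he).2 hb, hj.tail ⟨e, ⟨he, (hU e he).2 hb, hb⟩, Or.inr ⟨rfl, rfl⟩⟩⟩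

/-- The edges in `F` join any two vertices of `D`; the walks may leave `D`. -/
def Connects (s t : β → α) (F : Set β) (D : Set α) : Prop :=
  ∀ x ∈ D, ∀ y ∈ D, EdgeJoined s t F x y

/-- The incidence vector of an edge, for the orientation from `t e` to `s e`. -/
noncomputable def edgeVec (s t : β → α) (e : β) : α →₀ ℚ :=
  Finsupp.single (s e) 1 - Finsupp.single (t e) 1

/-- The space spanned by the incidence vectors of the edges in `F`; its dimension is the rank of
`F` in the graphic matroid. -/
noncomputable def edgeSpan (s t : β → α) (F : Set β) : Submodule ℚ (α →₀ ℚ) :=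
  Submodule.span ℚ (edgeVec s t '' F)

theorem edgeVec_mem_edgeSpan {F : Set β} {e : β} (he : e ∈ F) :
    edgeVec s t e ∈ edgeSpan s t F :=
  Submodule.subset_span ⟨e, he, rfl⟩

theorem edgeJoined_iff_single_sub_single_mem_edgeSpan {F : Set β} {x y : α} :
    EdgeJoined s t F x y ↔ Finsupp.single x 1 - Finsupp.single y 1 ∈ edgeSpan s t F := by
  classical
  constructor
  · intro h
    induction h with
    | refl => simp
    | tail _ h ih =>
      rw [← sub_add_sub_cancel]
      refine add_mem ih ?_
      obtain ⟨e, he, ⟨rfl, rfl⟩ | ⟨rfl, rfl⟩⟩ := h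
      · exact edgeVec_mem_edgeSpan he
      · rw [← neg_sub]
        exact neg_mem (edgeVec_mem_edgeSpan he)
  · intro h
    -- the functional summing the coordinates over the component of `x` vanishes on `edgeSpan s t F`
    let φ : (α →₀ ℚ) →ₗ[ℚ] ℚ :=
      Finsupp.linearCombination ℚ fun z => if EdgeJoined s t F x z then 1 else 0
    have hφ : edgeSpan s t F ≤ LinearMap.ker φ := by
      refine Submodule.span_le.2 ?_
      rintro _ ⟨e, he, rfl⟩
      have hiff : EdgeJoined s t F x (s e) ↔ EdgeJoined s t F x (t e) :=
        ⟨fun h => h.trans (EdgeJoined.of_mem he), fun h => h.trans (EdgeJoined.of_mem he).symm⟩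
      simp [φ, edgeVec, hiff]
    have hφxy : φ (Finsupp.single x 1 - Finsupp.single y 1) = 0 := hφ h
    by_contra hxy
    simp [φ, hxy, show EdgeJoined s t F x x from .refl] at hφxy

/-- The space spanned by the differences of two basis vectors indexed by `D`. -/
noncomputable def differenceSpan (D : Set α) : Submodule ℚ (α →₀ ℚ) :=
  Submodule.span ℚ {u | ∃ x ∈ D, ∃ y ∈ D, u = Finsupp.single x 1 - Finsupp.single y 1}

theorem single_sub_single_mem_differenceSpan {D : Set α} {x y : α} (hx : x ∈ D) (hy : y ∈ D) :
    Finsupp.single x 1 - Finsupp.single y 1 ∈ differenceSpan D :=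
  Submodule.subset_span ⟨x, hx, y, hy, rfl⟩

theorem connects_iff_differenceSpan_le {F : Set β} {D : Set α} :
    Connects s t F D ↔ differenceSpan D ≤ edgeSpan s t F := by
  simp only [Connects, edgeJoined_iff_single_sub_single_mem_edgeSpan]
  constructor
  · intro h
    refine Submodule.span_le.2 ?_
    rintro _ ⟨x, hx, y, hy, rfl⟩
    exact h x hx y hy
  · exact fun h x hx y hy => h (single_sub_single_mem_differenceSpan hx hy)

theorem edgeSpan_le_differenceSpan {F : Set β} {D : Set α} (hF : F ⊆ endsIn s t D) :
    edgeSpan s t F ≤ differenceSpan D := by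
  refine Submodule.span_le.2 ?_
  rintro _ ⟨e, he, rfl⟩
  exact single_sub_single_mem_differenceSpan (hF he).1 (hF he).2

theorem linearIndepOn_single_sub_single (x : α) {D : Set α} (hx : x ∉ D) :
    LinearIndepOn ℚ (fun y => (Finsupp.single y 1 - Finsupp.single x 1 : α →₀ ℚ)) D := by
  classical
  rw [linearIndepOn_iff']
  intro T g hT hsum y hy
  have hcoord := DFunLike.congr_fun hsum y
  have hxy : x ≠ y := fun h => hx (h ▸ hT hy)
  simpa [Finsupp.finsetSum_apply, Finsupp.single_apply, hxy, hy] using hcoord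

theorem differenceSpan_eq_span_image {D : Set α} {x : α} (hx : x ∈ D) :
    differenceSpan D = Submodule.span ℚ
      ((fun y => (Finsupp.single y 1 - Finsupp.single x 1 : α →₀ ℚ)) '' (D \ {x})) := by
  refine le_antisymm (Submodule.span_le.2 ?_) (Submodule.span_le.2 ?_)
  · have hmem : ∀ y ∈ D, (Finsupp.single y 1 - Finsupp.single x 1 : α →₀ ℚ) ∈ Submodule.span ℚ
        ((fun y => (Finsupp.single y 1 - Finsupp.single x 1 : α →₀ ℚ)) '' (D \ {x})) := by
      intro y hy
      obtain rfl | hyx := eq_or_ne y x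
      · simp
      · exact Submodule.subset_span ⟨y, ⟨hy, hyx⟩, rfl⟩
    rintro _ ⟨y, hy, z, hz, rfl⟩
    rw [← sub_sub_sub_cancel_right _ _ (Finsupp.single x 1)]
    exact sub_mem (hmem y hy) (hmem z hz)
  · rintro _ ⟨y, hy, rfl⟩
    exact single_sub_single_mem_differenceSpan hy.1 hx

theorem finrank_span_image_eq_card {K M ι : Type*} [DivisionRing K] [AddCommGroup M] [Module K M]
    {v : ι → M} {F : Finset ι} (h : LinearIndepOn K v (F : Set ι)) :
    Module.finrank K (Submodule.span K (v '' F)) = F.card := by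
  have hrank := finrank_span_eq_card (R := K) (b := fun x : (F : Set ι) => v x) h
  rwa [← Set.image_eq_range, ← Nat.card_eq_fintype_card, Nat.card_coe_set_eq,
    Set.ncard_coe_finset] at hrank

theorem finrank_edgeSpan_le (F : Finset β) :
    Module.finrank ℚ (edgeSpan s t (F : Set β)) ≤ F.card := by
  classical
  rw [edgeSpan, ← Finset.coe_image]
  exact (finrank_span_finset_le_card _).trans Finset.card_image_le

instance finiteDimensional_edgeSpan (F : Finset β) :
    FiniteDimensional ℚ (edgeSpan s t (F : Set β)) :=
  FiniteDimensional.span_of_finite ℚ (F.finite_toSet.image _)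

theorem finrank_differenceSpan_add_one {D : Finset α} (hD : D.Nonempty) :
    Module.finrank ℚ (differenceSpan (D : Set α)) + 1 = D.card := by
  classical
  obtain ⟨x, hx⟩ := hD
  rw [differenceSpan_eq_span_image (Finset.mem_coe.2 hx), ← Finset.coe_erase,
    finrank_span_image_eq_card (linearIndepOn_single_sub_single x (by simp)),
    Finset.card_erase_add_one hx]

instance finiteDimensional_differenceSpan (D : Finset α) :
    FiniteDimensional ℚ (differenceSpan (D : Set α)) := by
  refine FiniteDimensional.span_of_finite ℚ (((D ×ˢ D).finite_toSet.image
    fun p => Finsupp.single p.1 1 - Finsupp.single p.2 1).subset ?_)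
  rintro _ ⟨x, hx, y, hy, rfl⟩
  exact ⟨(x, y), by simpa using ⟨hx, hy⟩, rfl⟩

theorem Connects.card_le {F : Finset β} {D : Finset α} (h : Connects s t (F : Set β) D) :
    D.card ≤ F.card + 1 := by
  obtain rfl | hD := D.eq_empty_or_nonempty
  · simp
  · rw [← finrank_differenceSpan_add_one hD]
    gcongr
    exact (Submodule.finrank_mono (connects_iff_differenceSpan_le.1 h)).trans
      (finrank_edgeSpan_le F)

theorem card_lt_of_linearIndepOn_edgeVec {F : Finset β} {D : Finset α} (hD : D.Nonempty)
    (hF : (F : Set β) ⊆ endsIn s t D) (hind : LinearIndepOn ℚ (edgeVec s t) (F : Set β)) :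
    F.card < D.card := by
  rw [← finrank_differenceSpan_add_one hD, Nat.lt_succ_iff, ← finrank_span_image_eq_card hind]
  exact Submodule.finrank_mono (edgeSpan_le_differenceSpan hF)

theorem connects_of_linearIndepOn_edgeVec {F : Finset β} {D : Finset α}
    (hF : (F : Set β) ⊆ endsIn s t D) (hind : LinearIndepOn ℚ (edgeVec s t) (F : Set β))
    (hcard : F.card + 1 = D.card) : Connects s t (F : Set β) (D : Set α) := by
  have hD : D.Nonempty := Finset.card_pos.1 (by omega)
  refine connects_iff_differenceSpan_le.2
    (Submodule.eq_of_le_of_finrank_eq (edgeSpan_le_differenceSpan hF) ?_).ge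
  have hrank : Module.finrank ℚ (edgeSpan s t (F : Set β)) = F.card :=
    finrank_span_image_eq_card hind
  have := finrank_differenceSpan_add_one hD
  omega

theorem Connects.exists_linearIndepOn_subset {F : Set β} {D : Set α} (h : Connects s t F D) :
    ∃ B ⊆ F, LinearIndepOn ℚ (edgeVec s t) B ∧ Connects s t B D := by
  obtain ⟨B, hBF, -, hspan, hind⟩ := exists_linearIndepOn_extension
    (linearIndepOn_empty ℚ (edgeVec s t)) (Set.empty_subset F)
  exact ⟨B, hBF, hind, connects_iff_differenceSpan_le.2
    ((connects_iff_differenceSpan_le.1 h).trans (Submodule.span_le.2 hspan))⟩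

end EdgeVectors

section NashWilliams

variable {α β : Type*} {s t : β → α} {m : ℕ}

theorem coe_filter_eq_colorClass {ι : Type*} [DecidableEq ι] (c : β → ι) (F : Finset β) (i : ι) :
    ((F.filter fun f => c f = i : Finset β) : Set β) = colorClass c (F : Set β) i :=
  Finset.coe_filter _ _

theorem sum_card_colorClass_add_one (c : β → Fin m) (F : Finset β) :
    ∑ i, ((F.filter fun f => c f = i).card + 1) = F.card + m := by
  rw [Finset.sum_add_distrib, ← Finset.card_eq_sum_card_fiberwise (by simp)]
  simp

theorem mul_card_le_of_forall_connects {F : Finset β} {D : Finset α} {c : β → Fin m}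
    (h : ∀ i, Connects s t (colorClass c (F : Set β) i) (D : Set α)) :
    m * D.card ≤ F.card + m := by
  calc m * D.card = ∑ _i : Fin m, D.card := by simp
    _ ≤ ∑ i, ((F.filter fun f => c f = i).card + 1) := Finset.sum_le_sum fun i _ =>
        Connects.card_le (by rw [coe_filter_eq_colorClass]; exact h i)
    _ = F.card + m := sum_card_colorClass_add_one c F

theorem IsIndepColoring.card_colorClass_lt {F : Finset β} {D : Finset α} {c : β → Fin m}
    (hc : IsIndepColoring ℚ (edgeVec s t) (F : Set β) c) (hD : D.Nonempty)
    (hF : (F : Set β) ⊆ endsIn s t D) (i : Fin m) :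
    (F.filter fun f => c f = i).card < D.card := by
  refine card_lt_of_linearIndepOn_edgeVec hD
    ((Finset.coe_subset.2 (Finset.filter_subset _ _)).trans hF) ?_
  rw [coe_filter_eq_colorClass]
  exact hc i

theorem IsIndepColoring.card_add_le {F : Finset β} {D : Finset α} {c : β → Fin m}
    (hc : IsIndepColoring ℚ (edgeVec s t) (F : Set β) c) (hD : D.Nonempty)
    (hF : (F : Set β) ⊆ endsIn s t D) : F.card + m ≤ m * D.card := by
  calc F.card + m = ∑ i, ((F.filter fun f => c f = i).card + 1) :=
        (sum_card_colorClass_add_one c F).symm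
    _ ≤ ∑ _i : Fin m, D.card := Finset.sum_le_sum fun i _ => hc.card_colorClass_lt hD hF i
    _ = m * D.card := by simp

theorem IsIndepColoring.connects {F : Finset β} {D : Finset α} {c : β → Fin m}
    (hc : IsIndepColoring ℚ (edgeVec s t) (F : Set β) c) (hD : D.Nonempty)
    (hF : (F : Set β) ⊆ endsIn s t D) (hcard : m * D.card ≤ F.card + m) (i : Fin m) :
    Connects s t (colorClass c (F : Set β) i) (D : Set α) := by
  have hle : ∀ j ∈ Finset.univ, (F.filter fun f => c f = j).card + 1 ≤ D.card :=
    fun j _ => hc.card_colorClass_lt hD hF j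
  have hsum : ∑ j : Fin m, ((F.filter fun f => c f = j).card + 1) = ∑ _j : Fin m, D.card := by
    rw [sum_card_colorClass_add_one]
    simpa using le_antisymm (hc.card_add_le hD hF) hcard
  have heq := (Finset.sum_eq_sum_iff_of_le hle).1 hsum i (Finset.mem_univ i)
  rw [← coe_filter_eq_colorClass]
  refine connects_of_linearIndepOn_edgeVec
    ((Finset.coe_subset.2 (Finset.filter_subset _ _)).trans hF) ?_ heq
  rw [coe_filter_eq_colorClass]
  exact hc i

open Classical in
/-- The edges in `F` with both ends in `W`. -/
noncomputable def edgesIn (s t : β → α) (F : Finset β) (W : Finset α) : Finset β :=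
  F.filter fun e => s e ∈ W ∧ t e ∈ W

@[simp]
theorem mem_edgesIn {F : Finset β} {W : Finset α} {e : β} :
    e ∈ edgesIn s t F W ↔ e ∈ F ∧ s e ∈ W ∧ t e ∈ W := by
  simp [edgesIn]

theorem edgesIn_subset (F : Finset β) (W : Finset α) : edgesIn s t F W ⊆ F :=
  fun _ he => (mem_edgesIn.1 he).1

theorem coe_edgesIn (F : Finset β) (W : Finset α) :
    (edgesIn s t F W : Set β) = ↑F ∩ endsIn s t W := by
  ext e
  simp [endsIn]

theorem edgesIn_mono {F F' : Finset β} {W W' : Finset α} (hF : F ⊆ F') (hW : W ⊆ W') :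
    edgesIn s t F W ⊆ edgesIn s t F' W' := by
  intro e
  simp only [mem_edgesIn]
  exact fun ⟨he, hs, ht⟩ => ⟨hF he, hW hs, hW ht⟩

/-- Every nonempty vertex set `W` spans at most `m * (|W| - 1)` edges of `F`. -/
def IsSparse (s t : β → α) (m : ℕ) (F : Finset β) : Prop :=
  ∀ W : Finset α, W.Nonempty → (edgesIn s t F W).card + m ≤ m * W.card

theorem IsSparse.mono {F F' : Finset β} (h : IsSparse s t m F) (hF : F' ⊆ F) :
    IsSparse s t m F' := fun W hW =>
  (Nat.add_le_add_right (Finset.card_le_card (edgesIn_mono hF subset_rfl)) _).trans (h W hW)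

theorem IsIndepColoring.isSparse {F : Finset β} {c : β → Fin m}
    (hc : IsIndepColoring ℚ (edgeVec s t) (F : Set β) c) : IsSparse s t m F := fun W hW =>
  (hc.mono (Finset.coe_subset.2 (edgesIn_subset F W))).card_add_le hW
    (by rw [coe_edgesIn]; exact Set.inter_subset_right)

/-- `U` is the vertex set of the component of `e` in the graph with edge set `A`. -/
theorem exists_mul_card_lt_of_obstruction {F : Finset β} {A : Set β} {e : β} {c : β → Fin m}
    (hAF : A ⊆ F) (heA : e ∈ A)
    (hA : ∀ i, ∀ f ∈ A, edgeVec s t f ∈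
      Submodule.span ℚ (edgeVec s t '' (A ∩ colorClass c (↑F \ {e}) i))) :
    ∃ U : Finset α, U.Nonempty ∧ m * U.card < (edgesIn s t F U).card + m := by
  classical
  let U : Finset α := (F.image s ∪ F.image t).filter fun y => EdgeJoined s t A (s e) y
  have hends : ∀ f ∈ A, s f ∈ F.image s ∪ F.image t ∧ t f ∈ F.image s ∪ F.image t :=
    fun f hf => ⟨Finset.mem_union_left _ (Finset.mem_image_of_mem _ (hAF hf)),
      Finset.mem_union_right _ (Finset.mem_image_of_mem _ (hAF hf))⟩
  have hclosed : ∀ f ∈ A, s f ∈ U ↔ t f ∈ U := by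
    intro f hf
    simp only [U, Finset.mem_filter, hends f hf, true_and]
    exact ⟨fun h => h.trans (EdgeJoined.of_mem hf), fun h => h.trans (EdgeJoined.of_mem hf).symm⟩
  have hsU : s e ∈ U := Finset.mem_filter.2 ⟨(hends e heA).1, .refl⟩
  have heU : e ∈ edgesIn s t F U := mem_edgesIn.2 ⟨hAF heA, hsU, (hclosed e heA).1 hsU⟩
  have hjoined : ∀ i, ∀ y ∈ U,
      EdgeJoined s t (colorClass c (edgesIn s t F U \ {e} : Finset β) i) (s e) y := by
    intro i y hy
    have hclass : EdgeJoined s t (A ∩ colorClass c (↑F \ {e}) i) (s e) y :=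
      (Finset.mem_filter.1 hy).2.of_forall fun f hf =>
        edgeJoined_iff_single_sub_single_mem_edgeSpan.2 (hA i f hf)
    refine (hclass.inter_of_closed (U := U) hsU fun f hf => hclosed f hf.1).mono ?_
    rintro f ⟨⟨-, ⟨hfF, hfe⟩, hfi⟩, hfU⟩
    exact ⟨by simpa using ⟨⟨hfF, hfU⟩, hfe⟩, hfi⟩
  have hcard := mul_card_le_of_forall_connects (c := c) (D := U) fun i y hy z hz =>
    (hjoined i y hy).symm.trans (hjoined i z hz)
  refine ⟨U, ⟨_, hsU⟩, hcard.trans_lt (Nat.add_lt_add_right ?_ m)⟩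
  exact Finset.card_lt_card ((Finset.sdiff_ssubset (by simpa using heU) (by simp)))

/-- Nash-Williams' arboricity theorem. -/
theorem IsSparse.exists_isIndepColoring (hm : 0 < m) {F : Finset β} (hF : IsSparse s t m F) :
    ∃ c : β → Fin m, IsIndepColoring ℚ (edgeVec s t) (F : Set β) c := by
  classical
  induction F using Finset.induction_on with
  | empty => exact ⟨fun _ => ⟨0, hm⟩, fun i => by simp [colorClass]⟩
  | @insert e F he ih =>
    obtain ⟨c, hc⟩ := ih (hF.mono (Finset.subset_insert _ _))
    rw [← Finset.erase_insert he, Finset.coe_erase] at hc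
    refine (hc.exists_extension_or_obstruction (by simp)).resolve_right ?_
    rintro ⟨A, hAF, heA, hA⟩
    obtain ⟨U, hU, hlt⟩ := exists_mul_card_lt_of_obstruction hAF heA hA
    exact (hF U hU).not_gt hlt

end NashWilliams

section Tight

variable {α β : Type*} {s t : β → α} {m : ℕ} {F F' : Finset β}

/-- A vertex set is tight if it spans exactly `m * (|W| - 1)` edges of `F`. -/
def IsTight (s t : β → α) (m : ℕ) (F : Finset β) (W : Finset α) : Prop :=
  W.Nonempty ∧ (edgesIn s t F W).card + m = m * W.card

theorem edgesIn_congr {C : Finset α} (h : ∀ e ∈ endsIn s t C, (e ∈ F' ↔ e ∈ F)) :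
    edgesIn s t F' C = edgesIn s t F C := by
  ext e
  simp only [mem_edgesIn]
  exact and_congr_left fun he => h e he

theorem IsTight.congr {C : Finset α} (hC : IsTight s t m F C)
    (h : ∀ e ∈ endsIn s t C, (e ∈ F' ↔ e ∈ F)) : IsTight s t m F' C :=
  ⟨hC.1, by rw [edgesIn_congr h, hC.2]⟩

theorem isTight_singleton (hF : IsSparse s t m F) (v : α) : IsTight s t m F {v} := by
  have hle := hF {v} (Finset.singleton_nonempty v)
  rw [Finset.card_singleton] at hle
  exact ⟨Finset.singleton_nonempty v, by rw [Finset.card_singleton]; omega⟩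

theorem card_edgesIn_add_card_edgesIn_le [DecidableEq α] (F : Finset β) (A B : Finset α) :
    (edgesIn s t F A).card + (edgesIn s t F B).card ≤
      (edgesIn s t F (A ∪ B)).card + (edgesIn s t F (A ∩ B)).card := by
  classical
  rw [← Finset.card_union_add_card_inter]
  refine Nat.add_le_add (Finset.card_le_card (Finset.union_subset ?_ ?_)) (Finset.card_le_card ?_)
  · exact edgesIn_mono subset_rfl Finset.subset_union_left
  · exact edgesIn_mono subset_rfl Finset.subset_union_right
  · intro e
    simp only [Finset.mem_inter, mem_edgesIn]
    tauto

theorem mul_card_union_add_mul_card_inter [DecidableEq α] (m : ℕ) (A B : Finset α) :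
    m * (A ∪ B).card + m * (A ∩ B).card = m * A.card + m * B.card := by
  rw [← mul_add, Finset.card_union_add_card_inter, mul_add]

theorem IsTight.union_inter [DecidableEq α] (hF : IsSparse s t m F) {A B : Finset α}
    (hA : IsTight s t m F A) (hB : IsTight s t m F B) (hAB : (A ∩ B).Nonempty) :
    IsTight s t m F (A ∪ B) ∧ IsTight s t m F (A ∩ B) := by
  have hsuper := card_edgesIn_add_card_edgesIn_le (s := s) (t := t) F A B
  have hmod := mul_card_union_add_mul_card_inter m A B
  have hunion := hF (A ∪ B) (hA.1.mono Finset.subset_union_left)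
  have hinter := hF (A ∩ B) hAB
  have hAcard := hA.2
  have hBcard := hB.2
  exact ⟨⟨hA.1.mono Finset.subset_union_left, by omega⟩, hAB, by omega⟩

theorem IsTight.union [DecidableEq α] (hF : IsSparse s t m F) {A B : Finset α} {x : α}
    (hA : IsTight s t m F A) (hB : IsTight s t m F B) (hxA : x ∈ A) (hxB : x ∈ B) :
    IsTight s t m F (A ∪ B) :=
  (hA.union_inter hF hB ⟨x, Finset.mem_inter.2 ⟨hxA, hxB⟩⟩).1

theorem IsTight.inter [DecidableEq α] (hF : IsSparse s t m F) {A B : Finset α} {x : α}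
    (hA : IsTight s t m F A) (hB : IsTight s t m F B) (hxA : x ∈ A) (hxB : x ∈ B) :
    IsTight s t m F (A ∩ B) :=
  (hA.union_inter hF hB ⟨x, Finset.mem_inter.2 ⟨hxA, hxB⟩⟩).2

theorem IsTight.exists_least (hF : IsSparse s t m F) {Q : Finset α} {x y : α}
    (hQ : IsTight s t m F Q) (hx : x ∈ Q) (hy : y ∈ Q) :
    ∃ W, IsTight s t m F W ∧ x ∈ W ∧ y ∈ W ∧
      ∀ Z, IsTight s t m F Z → x ∈ Z → y ∈ Z → W ⊆ Z := by
  classical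
  obtain ⟨W, ⟨hW, hxW, hyW⟩, hmin⟩ := exists_minimal_of_wellFoundedLT
    (fun W => IsTight s t m F W ∧ x ∈ W ∧ y ∈ W) ⟨Q, hQ, hx, hy⟩
  refine ⟨W, hW, hxW, hyW, fun Z hZ hxZ hyZ => ?_⟩
  have hle := hmin (y := Z ∩ W) ⟨hZ.inter hF hW hxZ hxW, by simp [hxZ, hxW], by simp [hyZ, hyW]⟩
    Finset.inter_subset_right
  exact hle.trans Finset.inter_subset_left

theorem IsTight.exists_edge_at (hm : 0 < m) (hF : IsSparse s t m F) {W : Finset α}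
    (hW : IsTight s t m F W) {x z : α} (hx : x ∈ W) (hz : z ∈ W) (hxz : x ≠ z) :
    ∃ f ∈ edgesIn s t F W, s f = z ∨ t f = z := by
  classical
  by_contra! hno
  have hsub : edgesIn s t F W ⊆ edgesIn s t F (W.erase z) := by
    intro f hf
    have hfz := hno f hf
    rw [mem_edgesIn] at hf
    simp [hf, hfz]
  have hle := Finset.card_le_card hsub
  have hsparse := hF (W.erase z) ⟨x, by simp [hx, hxz]⟩
  have htight := hW.2
  rw [← Finset.card_erase_add_one hz, mul_add] at htight
  omega

theorem IsSparse.exchange [DecidableEq β] (hF : IsSparse s t m F) {e f : β} {W : Finset α}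
    (hW : ∀ Z, IsTight s t m F Z → s e ∈ Z → t e ∈ Z → W ⊆ Z) (hf : f ∈ edgesIn s t F W) :
    IsSparse s t m (insert e (F.erase f)) := by
  intro Z hZ
  have hFZ := hF Z hZ
  by_cases heZ : e ∈ endsIn s t Z
  · have hsub : edgesIn s t (insert e (F.erase f)) Z ⊆ insert e ((edgesIn s t F Z).erase f) := by
      intro g
      simp only [mem_edgesIn, Finset.mem_insert, Finset.mem_erase]
      tauto
    have hcard := (Finset.card_le_card hsub).trans (Finset.card_insert_le _ _)
    by_cases hfZ : f ∈ edgesIn s t F Z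
    · have := Finset.card_erase_add_one hfZ
      omega
    · have hslack : (edgesIn s t F Z).card + m ≠ m * Z.card := fun h =>
        hfZ (edgesIn_mono subset_rfl (hW Z ⟨hZ, h⟩ heZ.1 heZ.2) hf)
      rw [Finset.erase_eq_of_notMem hfZ] at hcard
      omega
  · refine le_trans (Nat.add_le_add_right (Finset.card_le_card ?_) _) hFZ
    intro g
    simp only [mem_edgesIn, Finset.mem_insert, Finset.mem_erase]
    rintro ⟨rfl | hg, hgZ⟩
    · exact absurd hgZ heZ
    · exact ⟨hg.2, hgZ⟩

/-- The edges of `F'` inside `C` together with the edges of `F` not inside `C`. -/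
noncomputable def swapInside (s t : β → α) (F F' : Finset β) (C : Finset α) : Finset β :=
  open Classical in (F \ edgesIn s t F C) ∪ edgesIn s t F' C

theorem mem_swapInside_of_mem_endsIn {C : Finset α} {e : β} (he : e ∈ endsIn s t C) :
    e ∈ swapInside s t F F' C ↔ e ∈ F' := by
  have he' : s e ∈ C ∧ t e ∈ C := he
  simp [swapInside, he']

theorem mem_swapInside_of_notMem_endsIn {C : Finset α} {e : β} (he : e ∉ endsIn s t C) :
    e ∈ swapInside s t F F' C ↔ e ∈ F := by
  have he' : ¬ (s e ∈ C ∧ t e ∈ C) := he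
  simp [swapInside, he']

theorem swapInside_subset {E : Set β} {C : Finset α} (hF : (F : Set β) ⊆ E)
    (hF' : (F' : Set β) ⊆ E) : (swapInside s t F F' C : Set β) ⊆ E := by
  classical
  rw [swapInside, Finset.coe_union, Finset.coe_sdiff]
  exact Set.union_subset (Set.sdiff_subset.trans hF)
    ((Finset.coe_subset.2 (edgesIn_subset _ _)).trans hF')

theorem card_swapInside {C : Finset α}
    (h : (edgesIn s t F C).card = (edgesIn s t F' C).card) :
    (swapInside s t F F' C).card = F.card := by
  classical
  have hdisj : Disjoint (F \ edgesIn s t F C) (edgesIn s t F' C) := by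
    rw [Finset.disjoint_left]
    intro e
    simp only [Finset.mem_sdiff, mem_edgesIn]
    tauto
  rw [swapInside, Finset.card_union_of_disjoint hdisj, ← h]
  exact Finset.card_sdiff_add_card_eq_card (edgesIn_subset F C)

theorem IsSparse.swapInside (hF : IsSparse s t m F) (hF' : IsSparse s t m F') {C : Finset α}
    (hC : IsTight s t m F C) : IsSparse s t m (swapInside s t F F' C) := by
  classical
  intro W hW
  by_cases hWC : (W ∩ C).Nonempty
  · have hsub : edgesIn s t (_root_.swapInside s t F F' C) W ⊆
        (edgesIn s t F W \ edgesIn s t F (W ∩ C)) ∪ edgesIn s t F' (W ∩ C) := by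
      intro e
      simp only [_root_.swapInside, mem_edgesIn, Finset.mem_union, Finset.mem_sdiff,
        Finset.mem_inter]
      tauto
    have hcard := (Finset.card_le_card hsub).trans (Finset.card_union_le _ _)
    have hsdiff := Finset.card_sdiff_add_card_eq_card (edgesIn_mono (s := s) (t := t)
      (subset_refl F) (Finset.inter_subset_left (s₁ := W) (s₂ := C)))
    have hinter := hF' (W ∩ C) hWC
    have hunion := hF (W ∪ C) (hW.mono Finset.subset_union_left)
    have htight := hC.2
    have hsuper := card_edgesIn_add_card_edgesIn_le (s := s) (t := t) F W C
    have hmod := mul_card_union_add_mul_card_inter m W C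
    omega
  · rw [edgesIn_congr fun e he => mem_swapInside_of_notMem_endsIn fun heC =>
      hWC ⟨s e, Finset.mem_inter.2 ⟨he.1, heC.1⟩⟩]
    exact hF W hW

/-- `F'` and `F` have the same edges not inside `C`. -/
def AgreeOff (s t : β → α) (C : Finset α) (F' F : Finset β) : Prop :=
  ∀ e ∉ endsIn s t C, (e ∈ F' ↔ e ∈ F)

theorem AgreeOff.mono {C D : Finset α} (h : AgreeOff s t C F' F) (hCD : C ⊆ D) :
    AgreeOff s t D F' F :=
  fun e he => h e fun heC => he ⟨hCD heC.1, hCD heC.2⟩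

theorem AgreeOff.trans {C : Finset α} {F'' : Finset β} (h : AgreeOff s t C F'' F')
    (h' : AgreeOff s t C F' F) : AgreeOff s t C F'' F :=
  fun e he => (h e he).trans (h' e he)

theorem AgreeOff.card_edgesIn_eq {C : Finset α} (h : AgreeOff s t C F' F)
    (hcard : F'.card = F.card) : (edgesIn s t F' C).card = (edgesIn s t F C).card := by
  classical
  have hsdiff : F' \ edgesIn s t F' C = F \ edgesIn s t F C := by
    ext e
    have he := h e
    simp only [endsIn, Set.mem_ofPred_eq, Finset.mem_coe] at he
    simp only [Finset.mem_sdiff, mem_edgesIn]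
    tauto
  have hF' := Finset.card_sdiff_add_card_eq_card (edgesIn_subset (s := s) (t := t) F' C)
  have hF := Finset.card_sdiff_add_card_eq_card (edgesIn_subset (s := s) (t := t) F C)
  rw [hsdiff] at hF'
  omega

theorem AgreeOff.isTight_iff {C : Finset α} (h : AgreeOff s t C F' F)
    (hcard : F'.card = F.card) : IsTight s t m F' C ↔ IsTight s t m F C := by
  rw [IsTight, IsTight, h.card_edgesIn_eq hcard]

theorem AgreeOff.mem_iff_of_disjoint {C D : Finset α} (h : AgreeOff s t C F' F)
    (hCD : Disjoint C D) {e : β} (he : e ∈ endsIn s t D) : e ∈ F' ↔ e ∈ F :=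
  h e fun heC => Finset.disjoint_left.1 hCD heC.1 he.1

theorem AgreeOff.isTight_of_disjoint {C D : Finset α} (h : AgreeOff s t C F' F)
    (hCD : Disjoint C D) (hD : IsTight s t m F D) : IsTight s t m F' D :=
  hD.congr fun _ he => h.mem_iff_of_disjoint hCD he

open Classical in
/-- The number of edges of `F` incident with `v`. -/
noncomputable def edgeDegree (s t : β → α) (F : Finset β) (v : α) : ℕ :=
  (F.filter fun e => s e = v ∨ t e = v).card

theorem AgreeOff.edgeDegree_eq {C : Finset α} (h : AgreeOff s t C F' F) {v : α} (hv : v ∉ C) :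
    edgeDegree s t F' v = edgeDegree s t F v := by
  classical
  unfold edgeDegree
  congr 1
  ext e
  simp only [Finset.mem_filter]
  refine and_congr_left fun he => h e fun heC => hv ?_
  obtain rfl | rfl := he
  exacts [heC.1, heC.2]

theorem edgeDegree_mono (h : F' ⊆ F) (v : α) : edgeDegree s t F' v ≤ edgeDegree s t F v := by
  classical
  exact Finset.card_le_card (Finset.filter_subset_filter _ h)

theorem edgeDegree_insert_le [DecidableEq β] (F : Finset β) (e : β) (v : α) :
    edgeDegree s t (insert e F) v ≤ edgeDegree s t F v + 1 := by
  classical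
  unfold edgeDegree
  rw [Finset.filter_insert]
  split_ifs
  · exact Finset.card_insert_le _ _
  · exact Nat.le_succ _

theorem edgeDegree_insert_of_ne [DecidableEq β] (F : Finset β) {e : β} {v : α} (hs : s e ≠ v)
    (ht : t e ≠ v) : edgeDegree s t (insert e F) v = edgeDegree s t F v := by
  classical
  unfold edgeDegree
  rw [Finset.filter_insert, if_neg (by simp [hs, ht])]

theorem edgeDegree_erase_add_one [DecidableEq β] {f : β} {v : α} (hf : f ∈ F)
    (hv : s f = v ∨ t f = v) : edgeDegree s t (F.erase f) v + 1 = edgeDegree s t F v := by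
  classical
  unfold edgeDegree
  rw [Finset.filter_erase, Finset.card_erase_add_one]
  simp [hf, hv]

end Tight

section Saturation

variable {α β : Type*} {s t : β → α} {m : ℕ} {V : Finset α} {E : Set β} {H H' H'' J : Finset β}
  {h : α → ℤ} {U U' : Finset α}

/-- `H` is a sparse set of `m * (|V| - 1)` edges of `E`. When `E` consists of edges on the vertex
set `V`, these sets are the unions of `m` edge-disjoint spanning trees. -/
structure IsTreeBase (s t : β → α) (m : ℕ) (V : Finset α) (E : Set β) (H : Finset β) : Prop where
  subset : (H : Set β) ⊆ E
  sparse : IsSparse s t m H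
  card_eq : H.card + m = m * V.card

theorem IsTreeBase.card_eq_card (hH : IsTreeBase s t m V E H) (hH' : IsTreeBase s t m V E H') :
    H'.card = H.card :=
  Nat.add_right_cancel (hH'.card_eq.trans hH.card_eq.symm)

theorem IsTreeBase.isTight (hH : IsTreeBase s t m V E H) (hE : E ⊆ endsIn s t V)
    (hV : V.Nonempty) : IsTight s t m H V := by
  refine ⟨hV, ?_⟩
  rw [← hH.card_eq]
  congr 2
  ext e
  simp only [mem_edgesIn, and_iff_left_iff_imp]
  exact fun he => hE (hH.subset he)

theorem IsTreeBase.subset_of_isTight (hm : 0 < m) (hH : IsTreeBase s t m V E H)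
    (hE : E ⊆ endsIn s t V) {C : Finset α} {x : α} (hC : IsTight s t m H C) (hxC : x ∈ C)
    (hxV : x ∈ V) : C ⊆ V := by
  classical
  have htight := (hC.union hH.sparse (hH.isTight hE ⟨x, hxV⟩) hxC hxV).2
  have hle := Finset.card_le_card (edgesIn_subset (s := s) (t := t) H (C ∪ V))
  have hcard := hH.card_eq
  have hmul : m * (C ∪ V).card ≤ m * V.card := by omega
  rw [Finset.eq_of_subset_of_card_le Finset.subset_union_right
    (Nat.le_of_mul_le_mul_left hmul hm)]
  exact Finset.subset_union_left

theorem IsTreeBase.swapInside {C : Finset α} (hH : IsTreeBase s t m V E H)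
    (hH' : IsTreeBase s t m V E H') (hC : IsTight s t m H C) (hC' : IsTight s t m H' C) :
    IsTreeBase s t m V E (swapInside s t H H' C) where
  subset := swapInside_subset hH.subset hH'.subset
  sparse := hH.sparse.swapInside hH'.sparse hC
  card_eq := by rw [card_swapInside (Nat.add_right_cancel (hC.2.trans hC'.2.symm)), hH.card_eq]

/-- At every vertex the degree in `H'` is at most the bound `h` or at most the degree in `H`, so
that `H'` violates the bound `h` nowhere by more than `H` does. -/
def DegreeDominated (s t : β → α) (h : α → ℤ) (H' H : Finset β) : Prop :=
  ∀ v, (edgeDegree s t H' v : ℤ) ≤ max (h v) (edgeDegree s t H v)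

theorem DegreeDominated.refl (h : α → ℤ) (H : Finset β) : DegreeDominated s t h H H :=
  fun _ => le_max_right _ _

theorem DegreeDominated.trans (hJ : DegreeDominated s t h H'' H')
    (hH : DegreeDominated s t h H' H) : DegreeDominated s t h H'' H :=
  fun v => (hJ v).trans (max_le (le_max_left _ _) (hH v))

theorem degreeDominated_insert_erase [DecidableEq β] {e : β} (f : β)
    (hs : (edgeDegree s t J (s e) : ℤ) < h (s e)) (ht : (edgeDegree s t J (t e) : ℤ) < h (t e)) :
    DegreeDominated s t h (insert e (J.erase f)) J := by
  intro v
  have hmono := edgeDegree_mono (s := s) (t := t) (Finset.erase_subset f J) v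
  by_cases hv : s e = v ∨ t e = v
  · have hinsert := edgeDegree_insert_le (s := s) (t := t) (J.erase f) e v
    refine le_max_of_le_left ?_
    obtain rfl | rfl := hv <;> omega
  · rw [edgeDegree_insert_of_ne _ (fun hsv => hv (.inl hsv)) fun htv => hv (.inr htv)]
    exact le_max_of_le_right (mod_cast hmono)

/-- The total excess over `V` of the degrees in `H` over the bound `h`. -/
noncomputable def totalExcess (s t : β → α) (V : Finset α) (h : α → ℤ) (H : Finset β) : ℕ :=
  ∑ v ∈ V, ((edgeDegree s t H v : ℤ) - h v).toNat

theorem DegreeDominated.totalExcess_lt (hdom : DegreeDominated s t h H' H) {z : α} (hz : z ∈ V)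
    (hviol : h z < edgeDegree s t H z) (hlt : edgeDegree s t H' z < edgeDegree s t H z) :
    totalExcess s t V h H' < totalExcess s t V h H := by
  refine Finset.sum_lt_sum (fun v _ => ?_) ⟨z, hz, by omega⟩
  have := hdom v
  omega

/-- `K` arises from the base `H` by rearranging edges inside the `H`-tight set `C`, which avoids
`U`, without aggravating violations of the degree bound `h`. -/
structure IsRearrangement (s t : β → α) (m : ℕ) (V : Finset α) (E : Set β) (h : α → ℤ)
    (H : Finset β) (U C : Finset α) (K : Finset β) : Prop where
  tight : IsTight s t m H C
  disjoint : Disjoint C U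
  base : IsTreeBase s t m V E K
  agree : AgreeOff s t C K H
  dominated : DegreeDominated s t h K H

theorem isRearrangement_singleton (hH : IsTreeBase s t m V E H) {v : α} (hv : v ∉ U) :
    IsRearrangement s t m V E h H U {v} H where
  tight := isTight_singleton hH.sparse v
  disjoint := Finset.disjoint_singleton_left.2 hv
  base := hH
  agree := fun _ _ => Iff.rfl
  dominated := .refl h H

theorem IsRearrangement.mono {C : Finset α} {K : Finset β}
    (hK : IsRearrangement s t m V E h H U' C K) (hU : U ⊆ U') :
    IsRearrangement s t m V E h H U C K :=
  { hK with disjoint := hK.disjoint.mono_right hU }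

theorem IsRearrangement.isTight {C : Finset α} {K : Finset β}
    (hK : IsRearrangement s t m V E h H U C K) (hH : IsTreeBase s t m V E H) :
    IsTight s t m K C :=
  (hK.agree.isTight_iff (hH.card_eq_card hK.base)).2 hK.tight

theorem IsRearrangement.merge [DecidableEq α] {C₁ C₂ Q : Finset α} {H₁ H₂ : Finset β} {x y : α}
    (hH : IsTreeBase s t m V E H) (h₁ : IsRearrangement s t m V E h H U C₁ H₁)
    (h₂ : IsRearrangement s t m V E h H U C₂ H₂) (hC : Disjoint C₁ C₂)
    (hQ : IsTight s t m H Q) (hQU : Disjoint Q U) (hxQ : x ∈ Q) (hx : x ∈ C₁) (hyQ : y ∈ Q)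
    (hy : y ∈ C₂) :
    ∃ J, IsRearrangement s t m V E h H U (Q ∪ (C₁ ∪ C₂)) J ∧ AgreeOff s t C₂ J H₁ ∧
      AgreeOff s t C₁ J H₂ ∧ AgreeOff s t (C₁ ∪ C₂) J H := by
  have agree₁ : AgreeOff s t C₂ (swapInside s t H₁ H₂ C₂) H₁ :=
    fun e he => mem_swapInside_of_notMem_endsIn he
  have agree₂ : AgreeOff s t C₁ (swapInside s t H₁ H₂ C₂) H₂ := by
    intro e he₁
    by_cases he₂ : e ∈ endsIn s t C₂
    · exact mem_swapInside_of_mem_endsIn he₂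
    · exact (agree₁ e he₂).trans ((h₁.agree e he₁).trans (h₂.agree e he₂).symm)
  have agree : AgreeOff s t (C₁ ∪ C₂) (swapInside s t H₁ H₂ C₂) H :=
    (agree₁.mono Finset.subset_union_right).trans (h₁.agree.mono Finset.subset_union_left)
  refine ⟨swapInside s t H₁ H₂ C₂, ⟨?_, ?_, ?_, ?_, ?_⟩, agree₁, agree₂, agree⟩
  · rw [← Finset.union_assoc]
    exact (hQ.union hH.sparse h₁.tight hxQ hx).union hH.sparse h₂.tight
      (Finset.mem_union_left _ hyQ) hy
  · exact Finset.disjoint_union_left.2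
      ⟨hQU, Finset.disjoint_union_left.2 ⟨h₁.disjoint, h₂.disjoint⟩⟩
  · exact h₁.base.swapInside h₂.base (h₁.agree.isTight_of_disjoint hC h₂.tight) (h₂.isTight hH)
  · exact agree.mono Finset.subset_union_right
  · intro v
    by_cases hv : v ∈ C₂
    · rw [agree₂.edgeDegree_eq (Finset.disjoint_right.1 hC hv)]
      exact h₂.dominated v
    · rw [agree₁.edgeDegree_eq hv]
      exact h₁.dominated v

theorem IsRearrangement.exchange [DecidableEq β] {Q W : Finset α} {e f : β}
    (hJ : IsRearrangement s t m V E h H U Q J) (hH : IsTreeBase s t m V E H)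
    (heE : e ∈ E) (heJ : e ∉ J) (heQ : e ∈ endsIn s t Q)
    (hs : (edgeDegree s t J (s e) : ℤ) < h (s e)) (ht : (edgeDegree s t J (t e) : ℤ) < h (t e))
    (hW : ∀ Z, IsTight s t m J Z → s e ∈ Z → t e ∈ Z → W ⊆ Z) (hf : f ∈ edgesIn s t J W) :
    IsRearrangement s t m V E h H U Q (insert e (J.erase f)) := by
  obtain ⟨hfJ, hfW⟩ := mem_edgesIn.1 hf
  have hWQ : W ⊆ Q := hW Q (hJ.isTight hH) heQ.1 heQ.2
  refine ⟨hJ.tight, hJ.disjoint, ⟨?_, hJ.base.sparse.exchange hW hf, ?_⟩, ?_,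
    (degreeDominated_insert_erase f hs ht).trans hJ.dominated⟩
  · rw [Finset.coe_insert]
    exact Set.insert_subset heE
      ((Finset.coe_subset.2 (Finset.erase_subset f J)).trans hJ.base.subset)
  · rw [Finset.card_insert_of_notMem fun h => heJ (Finset.mem_of_mem_erase h),
      Finset.card_erase_add_one hfJ, hJ.base.card_eq]
  · intro g hg
    have hge : g ≠ e := by
      rintro rfl
      exact hg heQ
    have hgf : g ≠ f := by
      rintro rfl
      exact hg ⟨hWQ hfW.1, hWQ hfW.2⟩
    rw [← hJ.agree g hg]
    simp [hge, hgf]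

theorem exists_isRearrangement_of_crossing (hm : 0 < m) (hH : IsTreeBase s t m V E H)
    (hU : U ⊆ U') {e : β} (heE : e ∈ E) (heH : e ∉ H) {Q C₁ C₂ : Finset α} {H₁ H₂ : Finset β}
    (hQ : IsTight s t m H Q) (hQU : Disjoint Q U) (heQ : e ∈ endsIn s t Q)
    (h₁ : IsRearrangement s t m V E h H U' C₁ H₁) (hs : s e ∈ C₁)
    (hroom₁ : (edgeDegree s t H₁ (s e) : ℤ) < h (s e))
    (h₂ : IsRearrangement s t m V E h H U' C₂ H₂) (ht : t e ∈ C₂)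
    (hroom₂ : (edgeDegree s t H₂ (t e) : ℤ) < h (t e))
    (hcross : ∀ C, IsTight s t m H C → Disjoint C U' → e ∉ endsIn s t C) :
    ∃ z ∈ U', ∃ Q' K, IsRearrangement s t m V E h H U Q' K ∧ z ∈ Q' ∧
      edgeDegree s t K z + 1 = edgeDegree s t H z := by
  classical
  have hC₁₂U' : Disjoint (C₁ ∪ C₂) U' := Finset.disjoint_union_left.2 ⟨h₁.disjoint, h₂.disjoint⟩
  have hC₁₂ : Disjoint C₁ C₂ := Finset.disjoint_left.2 fun x hx₁ hx₂ =>
    hcross _ (h₁.tight.union hH.sparse h₂.tight hx₁ hx₂) hC₁₂U' ⟨by simp [hs], by simp [ht]⟩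
  obtain ⟨J, hJ, agree₁, agree₂, agree⟩ :=
    (h₁.mono hU).merge hH (h₂.mono hU) hC₁₂ hQ hQU heQ.1 hs heQ.2 ht
  have heJ : e ∉ J := by
    rwa [agree₁ e fun he => Finset.disjoint_left.1 hC₁₂ hs he.1,
      h₁.agree e (hcross C₁ h₁.tight h₁.disjoint)]
  rw [← agree₁.edgeDegree_eq (Finset.disjoint_left.1 hC₁₂ hs)] at hroom₁
  rw [← agree₂.edgeDegree_eq (Finset.disjoint_right.1 hC₁₂ ht)] at hroom₂
  have heQ' : e ∈ endsIn s t (Q ∪ (C₁ ∪ C₂) : Finset α) := ⟨by simp [hs], by simp [ht]⟩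
  have hQ'J := hJ.isTight hH
  obtain ⟨W, hW, hsW, htW, hWmin⟩ := hQ'J.exists_least hJ.base.sparse heQ'.1 heQ'.2
  obtain ⟨z, hzW, hzU'⟩ : ∃ z ∈ W, z ∈ U' := by
    by_contra! hWU'
    have htight₁ := agree₁.isTight_of_disjoint hC₁₂.symm (h₁.isTight hH)
    have htight₂ := agree₂.isTight_of_disjoint hC₁₂ (h₂.isTight hH)
    have hunion := (hW.union hJ.base.sparse htight₁ hsW hs).union hJ.base.sparse htight₂
      (Finset.mem_union_left _ htW) ht
    rw [Finset.union_assoc] at hunion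
    refine hcross _ (((agree.mono Finset.subset_union_right).isTight_iff
      (hH.card_eq_card hJ.base)).1 hunion) ?_ ⟨by simp [hsW], by simp [htW]⟩
    exact Finset.disjoint_union_left.2 ⟨Finset.disjoint_left.2 hWU', hC₁₂U'⟩
  have hzC : z ∉ C₁ ∪ C₂ := Finset.disjoint_right.1 hC₁₂U' hzU'
  have hsz : s e ≠ z := fun h => hzC (by simp [← h, hs])
  have htz : t e ≠ z := fun h => hzC (by simp [← h, ht])
  obtain ⟨f, hf, hfz⟩ := hW.exists_edge_at hm hJ.base.sparse hsW hzW hsz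
  refine ⟨z, hzU', _, _, hJ.exchange hH heE heJ heQ' hroom₁ hroom₂ hWmin hf,
    hWmin _ hQ'J heQ'.1 heQ'.2 hzW, ?_⟩
  rw [edgeDegree_insert_of_ne _ hsz htz, edgeDegree_erase_add_one (mem_edgesIn.1 hf).1 hfz,
    agree.edgeDegree_eq hzC]

open Classical in
/-- The vertices whose degree no rearrangement avoiding `U` brings below the bound `h`. -/
noncomputable def saturate (s t : β → α) (m : ℕ) (V : Finset α) (E : Set β) (h : α → ℤ)
    (H : Finset β) (U : Finset α) : Finset α :=
  V.filter fun v => ∀ C K, IsRearrangement s t m V E h H U C K → v ∈ C → h v ≤ edgeDegree s t K v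

theorem mem_saturate {v : α} : v ∈ saturate s t m V E h H U ↔
    v ∈ V ∧ ∀ C K, IsRearrangement s t m V E h H U C K → v ∈ C → h v ≤ edgeDegree s t K v := by
  simp only [saturate, Finset.mem_filter]

theorem saturate_mono : Monotone (saturate s t m V E h H) := by
  intro U U' hU v
  simp only [mem_saturate]
  exact And.imp_right fun hv C K hK => hv C K (hK.mono hU)

theorem exists_isRearrangement_of_notMem_saturate {v : α} (hvV : v ∈ V)
    (hv : v ∉ saturate s t m V E h H U) :
    ∃ C K, IsRearrangement s t m V E h H U C K ∧ v ∈ C ∧ (edgeDegree s t K v : ℤ) < h v := by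
  rw [mem_saturate] at hv
  push Not at hv
  exact hv hvV

/-- The stages of the saturation process: `saturate` iterated on the empty set. -/
noncomputable def saturation (s t : β → α) (m : ℕ) (V : Finset α) (E : Set β) (h : α → ℤ)
    (H : Finset β) (n : ℕ) : Finset α :=
  (saturate s t m V E h H)^[n] ∅

theorem saturation_succ (n : ℕ) : saturation s t m V E h H (n + 1) =
    saturate s t m V E h H (saturation s t m V E h H n) :=
  Function.iterate_succ_apply' _ _ _

theorem saturation_mono : Monotone (saturation s t m V E h H) :=
  saturate_mono.monotone_iterate_of_le_map (Finset.empty_subset _)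

theorem saturation_subset (n : ℕ) : saturation s t m V E h H n ⊆ V := by
  cases n with
  | zero => exact Finset.empty_subset V
  | succ n =>
    rw [saturation_succ]
    exact fun v hv => (mem_saturate.1 hv).1

theorem exists_saturation_succ_eq (s t : β → α) (m : ℕ) (V : Finset α) (E : Set β) (h : α → ℤ)
    (H : Finset β) : ∃ n, saturation s t m V E h H (n + 1) = saturation s t m V E h H n := by
  by_contra! hne
  have hstrict : StrictMono fun n => (saturation s t m V E h H n).card :=
    strictMono_nat_of_lt_succ fun n => Finset.card_lt_card
      ((saturation_mono (Nat.le_succ n)).lt_of_ne (hne n).symm)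
  have hlarge := hstrict.le_apply (x := V.card + 1)
  have hsmall := Finset.card_le_card (saturation_subset (s := s) (t := t) (m := m) (V := V)
    (E := E) (h := h) (H := H) (V.card + 1))
  omega

theorem le_edgeDegree_of_mem_saturation (hH : IsTreeBase s t m V E H) {n : ℕ} {v : α}
    (hv : v ∈ saturation s t m V E h H n) : h v ≤ edgeDegree s t H v := by
  induction n with
  | zero => exact absurd hv (Finset.notMem_empty v)
  | succ n ih =>
    by_cases hvn : v ∈ saturation s t m V E h H n
    · exact ih hvn
    · rw [saturation_succ] at hv
      exact (mem_saturate.1 hv).2 {v} H (isRearrangement_singleton hH hvn)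
        (Finset.mem_singleton_self v)

theorem mem_saturate_of_lt_edgeDegree
    (hmin : ∀ K, IsTreeBase s t m V E K → totalExcess s t V h H ≤ totalExcess s t V h K)
    {v : α} (hvV : v ∈ V) (hv : h v < edgeDegree s t H v) : v ∈ saturate s t m V E h H U := by
  refine mem_saturate.2 ⟨hvV, fun C K hK _ => ?_⟩
  by_contra! hlt
  exact (hK.dominated.totalExcess_lt hvV hv (by omega)).not_ge (hmin K hK.base)

theorem exists_isTight_of_notMem_saturation (hm : 0 < m) (hH : IsTreeBase s t m V E H)
    (hE : E ⊆ endsIn s t V)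
    (hmin : ∀ K, IsTreeBase s t m V E K → totalExcess s t V h H ≤ totalExcess s t V h K)
    (n : ℕ) {e : β} (heE : e ∈ E) (heH : e ∉ H)
    (hs : s e ∉ saturation s t m V E h H (n + 1)) (ht : t e ∉ saturation s t m V E h H (n + 1)) :
    ∃ C, IsTight s t m H C ∧ Disjoint C (saturation s t m V E h H n) ∧ e ∈ endsIn s t C := by
  induction n with
  | zero =>
    exact ⟨V, hH.isTight hE ⟨_, (hE heE).1⟩, Finset.disjoint_empty_right V, hE heE⟩
  | succ n ih =>
    by_contra! hcross
    have hsub := saturation_mono (s := s) (t := t) (m := m) (V := V) (E := E) (h := h) (H := H)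
    obtain ⟨Q, hQ, hQU, heQ⟩ := ih (fun hmem => hs (hsub (Nat.le_succ _) hmem))
      fun hmem => ht (hsub (Nat.le_succ _) hmem)
    rw [saturation_succ (n + 1)] at hs ht
    obtain ⟨C₁, H₁, h₁, hsC₁, hroom₁⟩ :=
      exists_isRearrangement_of_notMem_saturate (hE heE).1 hs
    obtain ⟨C₂, H₂, h₂, htC₂, hroom₂⟩ :=
      exists_isRearrangement_of_notMem_saturate (hE heE).2 ht
    obtain ⟨z, hz, Q', K, hK, hzQ', hdeg⟩ := exists_isRearrangement_of_crossing hm hH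
      (hsub (Nat.le_succ n)) heE heH hQ hQU heQ h₁ hsC₁ hroom₁ h₂ htC₂ hroom₂ hcross
    rw [saturation_succ, mem_saturate] at hz
    have hbound := hz.2 Q' K hK hzQ'
    exact (hK.dominated.totalExcess_lt hz.1 (by omega) (by omega)).not_ge (hmin K hK.base)

theorem exists_saturated_set (hm : 0 < m) (hH : IsTreeBase s t m V E H) (hE : E ⊆ endsIn s t V)
    (hmin : ∀ K, IsTreeBase s t m V E K → totalExcess s t V h H ≤ totalExcess s t V h K) :
    ∃ S ⊆ V, (∀ v ∈ V, h v < edgeDegree s t H v → v ∈ S) ∧ (∀ v ∈ S, h v ≤ edgeDegree s t H v) ∧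
      ∀ e ∈ E, e ∉ H → s e ∉ S → t e ∉ S →
        ∃ C ⊆ V, IsTight s t m H C ∧ Disjoint C S ∧ e ∈ endsIn s t C := by
  obtain ⟨n, hn⟩ := exists_saturation_succ_eq s t m V E h H
  refine ⟨_, saturation_subset n, fun v hvV hv => ?_,
    fun v hv => le_edgeDegree_of_mem_saturation hH hv, fun e heE heH hs ht => ?_⟩
  · rw [← hn, saturation_succ]
    exact mem_saturate_of_lt_edgeDegree hmin hvV hv
  · rw [← hn] at hs ht
    obtain ⟨C, hC, hCS, heC⟩ := exists_isTight_of_notMem_saturation hm hH hE hmin n heE heH hs ht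
    exact ⟨C, hH.subset_of_isTight hm hE hC heC.1 (hE heE).1, hC, hCS, heC⟩

theorem exists_isTreeBase_le_or_saturated (hm : 0 < m) (hE : E ⊆ endsIn s t V)
    (hbase : ∃ H, IsTreeBase s t m V E H) (h : α → ℤ) (X : Set α) :
    ∃ H, IsTreeBase s t m V E H ∧ ((∀ v ∈ V, v ∈ X → (edgeDegree s t H v : ℤ) ≤ h v) ∨
      ∃ S ⊆ V, (S : Set α) ⊆ X ∧ ∑ v ∈ S, h v < ∑ v ∈ S, (edgeDegree s t H v : ℤ) ∧
        ∀ e ∈ E, e ∉ H → s e ∉ S → t e ∉ S →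
          ∃ C ⊆ V, IsTight s t m H C ∧ Disjoint C S ∧ e ∈ endsIn s t C) := by
  classical
  -- Outside `X` the bound exceeds the number of edges of a base, so it is never attained.
  let h' : α → ℤ := fun v => if v ∈ X then h v else m * V.card + 1
  have hin : ∀ v ∈ X, h' v = h v := fun v hv => if_pos hv
  have hout : ∀ v ∉ X, h' v = m * V.card + 1 := fun v hv => if_neg hv
  obtain ⟨H, hH, hmin⟩ :=
    exists_minimalFor_of_wellFoundedLT (IsTreeBase s t m V E) (totalExcess s t V h') hbase
  refine ⟨H, hH, or_iff_not_imp_left.2 fun hviol => ?_⟩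
  push Not at hviol
  obtain ⟨v, hvV, hvX, hv⟩ := hviol
  obtain ⟨S, hSV, hS, hle, hcover⟩ := exists_saturated_set (h := h') hm hH hE
    fun K hK => (le_total _ _).elim id fun hle => hmin hK hle
  have hSX : (S : Set α) ⊆ X := by
    intro u hu
    by_contra huX
    have hbound := hle u hu
    have hdeg : edgeDegree s t H u ≤ H.card := Finset.card_filter_le _ _
    have hcard := hH.card_eq
    rw [hout u huX] at hbound
    zify at hdeg hcard
    omega
  refine ⟨S, hSV, hSX, Finset.sum_lt_sum (fun u hu => ?_) ⟨v, hS v hvV ?_, hv⟩, hcover⟩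
  · rw [← hin u (hSX hu)]
    exact hle u hu
  · rwa [hin v hvX]

end Saturation

section Packing

variable {α β : Type*} {s t : β → α} {m : ℕ} {E : Set β} {H : Finset β}

/-- `D` is nonempty, and the edges of `E` inside `D` can be coloured with `m` colours such that
each colour class connects `D`. -/
def IsTreePacked (s t : β → α) (m : ℕ) (E : Set β) (D : Set α) : Prop :=
  D.Nonempty ∧ ∃ c : β → Fin m, ∀ i, Connects s t (colorClass c (E ∩ endsIn s t D) i) D

theorem isTreePacked_singleton (hm : 0 < m) (E : Set β) (v : α) : IsTreePacked s t m E {v} := by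
  refine ⟨Set.singleton_nonempty v, fun _ => ⟨0, hm⟩, ?_⟩
  rintro i x rfl y rfl
  exact .refl

theorem IsTreePacked.union {C D : Set α} {x : α} (hC : IsTreePacked s t m E C)
    (hD : IsTreePacked s t m E D) (hxC : x ∈ C) (hxD : x ∈ D) :
    IsTreePacked s t m E (C ∪ D) := by
  classical
  obtain ⟨hCne, c, hc⟩ := hC
  obtain ⟨-, d, hd⟩ := hD
  refine ⟨hCne.mono Set.subset_union_left, fun e => if e ∈ endsIn s t C then c e else d e,
    fun i => ?_⟩
  set F := colorClass (fun e => if e ∈ endsIn s t C then c e else d e)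
    (E ∩ endsIn s t (C ∪ D)) i
  have hsub : colorClass c (E ∩ endsIn s t C) i ⊆ F := fun e ⟨⟨heE, heC⟩, hei⟩ =>
    ⟨⟨heE, .inl heC.1, .inl heC.2⟩, (if_pos heC).trans hei⟩
  have hFC : Connects s t F C := fun y hy z hz => (hc i y hy z hz).mono hsub
  have hFD : Connects s t F D := by
    refine fun y hy z hz => (hd i y hy z hz).of_forall fun e ⟨⟨heE, heD⟩, hei⟩ => ?_
    by_cases heC : e ∈ endsIn s t C
    · exact hFC _ heC.1 _ heC.2
    · exact EdgeJoined.of_mem ⟨⟨heE, .inr heD.1, .inr heD.2⟩, (if_neg heC).trans hei⟩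
  have hx : ∀ y ∈ C ∪ D, EdgeJoined s t F x y := by
    rintro y (hy | hy)
    exacts [hFC x hxC y hy, hFD x hxD y hy]
  exact fun y hy z hz => (hx y hy).symm.trans (hx z hz)

theorem IsTight.connects_colorClass {c : β → Fin m} (hc : IsIndepColoring ℚ (edgeVec s t) H c)
    {C : Finset α} (hC : IsTight s t m H C) (i : Fin m) :
    Connects s t (colorClass c (H ∩ endsIn s t C) i) C := by
  rw [← coe_edgesIn]
  refine (hc.mono (Finset.coe_subset.2 (edgesIn_subset H C))).connects hC.1 ?_ hC.2.ge i
  rw [coe_edgesIn]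
  exact Set.inter_subset_right

theorem IsTight.isTreePacked (hm : 0 < m) (hH : IsSparse s t m H) (hHE : (H : Set β) ⊆ E)
    {C : Finset α} (hC : IsTight s t m H C) : IsTreePacked s t m E (C : Set α) := by
  obtain ⟨c, hc⟩ := hH.exists_isIndepColoring hm
  refine ⟨hC.1, c, fun i x hx y hy => (hC.connects_colorClass hc i x hx y hy).mono ?_⟩
  exact colorClass_mono (Set.inter_subset_inter_left _ hHE) i

theorem IsTreePacked.exists_isTreeBase (hE : E.Finite) {V : Finset α}
    (hV : IsTreePacked s t m E (V : Set α)) : ∃ H, IsTreeBase s t m V E H := by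
  obtain ⟨hVne, c, hc⟩ := hV
  choose B hBsub hBind hBconn using fun i => (hc i).exists_linearIndepOn_subset
  have hfin : {e | e ∈ B (c e)}.Finite := hE.subset fun e he => (hBsub _ he).1.1
  obtain ⟨H, hH⟩ := hfin.exists_finset_coe
  have hclass : ∀ i, colorClass c (H : Set β) i = B i := by
    intro i
    rw [hH]
    ext e
    exact ⟨fun ⟨he, hei⟩ => hei ▸ he, fun he =>
      have hei : c e = i := (hBsub i he).2
      ⟨by rwa [Set.mem_ofPred_eq, hei], hei⟩⟩
  have hcol : IsIndepColoring ℚ (edgeVec s t) (H : Set β) c := fun i => by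
    rw [hclass]
    exact hBind i
  have hsub : (H : Set β) ⊆ E ∩ endsIn s t V := by
    rw [hH]
    exact fun e he => (hBsub _ he).1
  refine ⟨H, hsub.trans Set.inter_subset_left, hcol.isSparse,
    (hcol.card_add_le hVne (hsub.trans Set.inter_subset_right)).antisymm
      (mul_card_le_of_forall_connects (s := s) (t := t) (c := c) fun i => ?_)⟩
  rw [hclass]
  exact hBconn i

theorem IsTreePacked.mul_card_le (hm : 0 < m) {D : Finset α} (hH : IsSparse s t m H)
    (hD : IsTreePacked s t m E (D : Set α))
    (hcover : ∀ e ∈ E, e ∉ H → e ∈ endsIn s t D →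
      ∃ C ⊆ D, IsTight s t m H C ∧ e ∈ endsIn s t C) :
    m * D.card ≤ (edgesIn s t H D).card + m := by
  classical
  obtain ⟨d, hd⟩ := hD.2
  obtain ⟨c, hc⟩ := hH.exists_isIndepColoring hm
  let Covered : β → Prop := fun e => ∃ C ⊆ D, IsTight s t m H C ∧ e ∈ endsIn s t C
  refine mul_card_le_of_forall_connects (s := s) (t := t)
    (c := fun e => if Covered e then c e else d e) fun i => ?_
  refine fun x hx y hy => (hd i x hx y hy).of_forall fun e ⟨⟨heE, heD⟩, hei⟩ => ?_
  rw [coe_edgesIn]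
  by_cases he : Covered e
  · obtain ⟨C, hCD, hC, heC⟩ := he
    refine (hC.connects_colorClass hc i _ heC.1 _ heC.2).mono fun f ⟨⟨hfH, hfC⟩, hfi⟩ => ?_
    have hf : Covered f := ⟨C, hCD, hC, hfC⟩
    exact ⟨⟨hfH, hCD hfC.1, hCD hfC.2⟩, (if_pos hf).trans hfi⟩
  · have heH : e ∈ H := by
      by_contra heH
      exact he (hcover e heE heH heD)
    exact EdgeJoined.of_mem ⟨⟨heH, heD⟩, (if_neg he).trans hei⟩

open Classical in
theorem sum_edgeDegree_le (F : Finset β) (S : Finset α) :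
    ∑ v ∈ S, edgeDegree s t F v ≤
      (F.filter fun e => s e ∈ S).card + (F.filter fun e => t e ∈ S).card := by
  rw [← Finset.sum_card_fiberwise_eq_card_filter F S s,
    ← Finset.sum_card_fiberwise_eq_card_filter F S t, ← Finset.sum_add_distrib]
  refine Finset.sum_le_sum fun v _ => ?_
  rw [edgeDegree, Finset.filter_or]
  exact Finset.card_union_le _ _

theorem card_edgesIn_add_sum_edgeDegree_le (F : Finset β) {S W : Finset α} (hSW : Disjoint S W) :
    (edgesIn s t F W).card + ∑ v ∈ S, edgeDegree s t F v ≤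
      F.card + (edgesIn s t F S).card := by
  classical
  have hsum := sum_edgeDegree_le (s := s) (t := t) F S
  rw [← Finset.card_union_add_card_inter, ← Finset.filter_and] at hsum
  have hdisj : Disjoint (edgesIn s t F W)
      ((F.filter fun e => s e ∈ S) ∪ F.filter fun e => t e ∈ S) := by
    rw [Finset.disjoint_left]
    intro e he
    obtain ⟨-, hs, ht⟩ := mem_edgesIn.1 he
    simp [Finset.disjoint_right.1 hSW hs, Finset.disjoint_right.1 hSW ht]
  have hcard := Finset.card_le_card (Finset.union_subset (edgesIn_subset (s := s) (t := t) F W)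
    (Finset.union_subset (Finset.filter_subset (fun e => s e ∈ S) F)
      (Finset.filter_subset (fun e => t e ∈ S) F)))
  rw [Finset.card_union_of_disjoint hdisj] at hcard
  have hinside : (edgesIn s t F S).card = (F.filter fun e => s e ∈ S ∧ t e ∈ S).card := by
    congr 1
  omega

end Packing

section TreeConnected

variable {α β : Type*} {K G : Graph α β} {s t : β → α} {m : ℕ}

/-- The edge `e` of `K` has the ends `s e` and `t e`. A choice of such functions reduces statements
about `K` to statements about its edge set; the order of the two ends plays no role. -/
def IsOrientation (K : Graph α β) (s t : β → α) : Prop :=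
  ∀ e ∈ E(K), K.IsLink e (s e) (t e)

theorem exists_isOrientation (hK : V(K).Nonempty) : ∃ s t, IsOrientation K s t := by
  obtain ⟨v, -⟩ := hK
  have hends : ∀ e, ∃ p : α × α, e ∈ E(K) → K.IsLink e p.1 p.2 := by
    intro e
    by_cases he : e ∈ E(K)
    · obtain ⟨x, y, hxy⟩ := K.exists_isLink_of_mem_edgeSet he
      exact ⟨(x, y), fun _ => hxy⟩
    · exact ⟨(v, v), fun h => absurd h he⟩
  choose p hp using hends
  exact ⟨fun e => (p e).1, fun e => (p e).2, hp⟩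

theorem IsOrientation.of_le (hst : IsOrientation G s t) (hK : K ≤ G) : IsOrientation K s t :=
  fun e he => (hK.isLink_iff he).2 (hst e (hK.edgeSet_mono he))

theorem IsOrientation.subset_endsIn (hst : IsOrientation K s t) : E(K) ⊆ endsIn s t V(K) :=
  fun e he => ⟨(hst e he).left_mem, (hst e he).right_mem⟩

theorem IsOrientation.edgeSet_induce (hst : IsOrientation K s t) (D : Set α) :
    E(K.induce D) = E(K) ∩ endsIn s t D := by
  ext e
  rw [Graph.edge_mem_iff_exists_isLink]
  simp only [Graph.induce_isLink]
  constructor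
  · rintro ⟨x, y, h, hx, hy⟩
    refine ⟨h.edge_mem, ?_⟩
    rcases h.eq_and_eq_or_eq_and_eq (hst e h.edge_mem) with ⟨rfl, rfl⟩ | ⟨rfl, rfl⟩
    exacts [⟨hx, hy⟩, ⟨hy, hx⟩]
  · rintro ⟨he, hs, ht⟩
    exact ⟨_, _, hst e he, hs, ht⟩

theorem IsOrientation.induce (hst : IsOrientation K s t) (D : Set α) :
    IsOrientation (K.induce D) s t := by
  intro e he
  rw [hst.edgeSet_induce] at he
  rw [Graph.induce_isLink]
  exact ⟨hst e he.1, he.2⟩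

theorem IsOrientation.linkedBy_iff_adj (hst : IsOrientation K s t) {x y : α} :
    LinkedBy s t E(K) x y ↔ K.Adj x y := by
  constructor
  · rintro ⟨e, he, ⟨rfl, rfl⟩ | ⟨rfl, rfl⟩⟩
    exacts [⟨e, hst e he⟩, ⟨e, (hst e he).symm⟩]
  · rintro ⟨e, hxy⟩
    exact ⟨e, hxy.edge_mem, (hst e hxy.edge_mem).eq_and_eq_or_eq_and_eq hxy⟩

theorem IsOrientation.isConnected_iff (hst : IsOrientation K s t) :
    K.IsConnected ↔ V(K).Nonempty ∧ Connects s t E(K) V(K) := by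
  have hadj : LinkedBy s t E(K) = K.Adj := by
    ext x y
    exact hst.linkedBy_iff_adj
  rw [Connects, EdgeJoined, hadj, Graph.IsConnected]

theorem IsOrientation.not_linearIndepOn_of_isCycle (hst : IsOrientation K s t) {n : ℕ}
    {v : Fin (n + 1) → α} {e : Fin (n + 1) → β} (hcycle : K.IsCycle n v e) :
    ¬ LinearIndepOn ℚ (edgeVec s t) E(K) := by
  intro hind
  obtain ⟨-, he, hlink⟩ := hcycle
  have hindep : LinearIndependent ℚ fun i => edgeVec s t (e i) :=
    LinearIndependent.comp (ι := E(K)) (v := fun x => edgeVec s t x) hind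
      (fun i => ⟨e i, (hlink i).edge_mem⟩) fun i j h => he (congrArg Subtype.val h)
  have hsign : ∀ i, ∃ a : ℚ, a ≠ 0 ∧ a • edgeVec s t (e i) =
      Finsupp.single (v i) 1 - Finsupp.single (v (i + 1)) 1 := by
    intro i
    rcases (hst _ (hlink i).edge_mem).eq_and_eq_or_eq_and_eq (hlink i) with ⟨hs, ht⟩ | ⟨hs, ht⟩
    · exact ⟨1, one_ne_zero, by simp [edgeVec, hs, ht]⟩
    · exact ⟨-1, by simp, by simp [edgeVec, hs, ht]⟩
  choose a ha hav using hsign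
  refine ha 0 (Fintype.linearIndependent_iff.1 hindep a ?_ 0)
  simp only [hav, Finset.sum_sub_distrib]
  rw [sub_eq_zero]
  exact (Equiv.sum_comp (Equiv.addRight (1 : Fin (n + 1)))
    fun i => (Finsupp.single (v i) 1 : α →₀ ℚ)).symm

theorem IsOrientation.isTree_restrict (hst : IsOrientation K s t) {B : Set β} (hB : B ⊆ E(K))
    (hK : V(K).Nonempty) (hind : LinearIndepOn ℚ (edgeVec s t) B) (hconn : Connects s t B V(K)) :
    (K.restrict B).IsTree := by
  have hstB := hst.of_le (Graph.restrict_le (E₀ := B))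
  have hE : E(K.restrict B) = B := Set.inter_eq_right.2 hB
  refine ⟨hstB.isConnected_iff.2 ⟨hK, ?_⟩, fun n v e hcycle => ?_⟩
  · rw [hE]
    exact hconn
  · refine hstB.not_linearIndepOn_of_isCycle hcycle ?_
    rw [hE]
    exact hind

theorem nonempty_of_isTreeConnected (hm : 0 < m) (hK : K.IsTreeConnected m) : V(K).Nonempty := by
  obtain ⟨T, hT, -⟩ := hK
  rw [← (hT ⟨0, hm⟩).1.vertexSet_eq]
  exact (hT ⟨0, hm⟩).2.1.1

theorem isTreePacked_of_isTreeConnected (hm : 0 < m) (hst : IsOrientation K s t)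
    (hK : K.IsTreeConnected m) : IsTreePacked s t m E(K) V(K) := by
  classical
  have hne := nonempty_of_isTreeConnected hm hK
  obtain ⟨T, hT, hdisj⟩ := hK
  have hconn : ∀ i, Connects s t E(T i) V(K) := fun i => by
    rw [← (hT i).1.vertexSet_eq]
    exact ((hst.of_le (hT i).1.le).isConnected_iff.1 (hT i).2.1).2
  refine ⟨hne, fun e => if he : ∃ i, e ∈ E(T i) then he.choose else ⟨0, hm⟩, fun i x hx y hy =>
    (hconn i x hx y hy).mono fun e he => ?_⟩
  have hex : ∃ i, e ∈ E(T i) := ⟨i, he⟩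
  have heK := (hT i).1.le.edgeSet_mono he
  refine ⟨⟨heK, hst.subset_endsIn heK⟩, (dif_pos hex).trans ?_⟩
  by_contra hcolor
  exact Set.disjoint_left.1 (hdisj _ _ hcolor) hex.choose_spec he

theorem isTreeConnected_of_isTreePacked (hst : IsOrientation K s t)
    (hK : IsTreePacked s t m E(K) V(K)) : K.IsTreeConnected m := by
  obtain ⟨hne, c, hc⟩ := hK
  choose B hBsub hBind hBconn using fun i => (hc i).exists_linearIndepOn_subset
  refine ⟨fun i => K.restrict (B i), fun i => ⟨⟨Graph.restrict_le, rfl⟩,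
    hst.isTree_restrict (fun e he => (hBsub i he).1.1) hne (hBind i) (hBconn i)⟩,
    fun i j hij => Set.disjoint_left.2 fun e hei hej => hij ?_⟩
  exact (hBsub i hei.2).2.symm.trans (hBsub j hej.2).2

theorem IsOrientation.isTreeConnected_induce_iff (hm : 0 < m) (hst : IsOrientation K s t)
    (D : Set α) : (K.induce D).IsTreeConnected m ↔ IsTreePacked s t m E(K) D := by
  have hpacked : IsTreePacked s t m E(K.induce D) V(K.induce D) ↔ IsTreePacked s t m E(K) D := by
    rw [hst.edgeSet_induce, Graph.vertexSet_induce, IsTreePacked, IsTreePacked, Set.inter_assoc,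
      Set.inter_self]
  rw [← hpacked]
  exact ⟨isTreePacked_of_isTreeConnected hm (hst.induce D),
    isTreeConnected_of_isTreePacked (hst.induce D)⟩

end TreeConnected

section TreeComponents

variable {α β : Type*} {K : Graph α β} {s t : β → α} {m : ℕ} {C D D' : Set α} {x : α}

theorem IsOrientation.mem_treeComponents_iff (hm : 0 < m) (hst : IsOrientation K s t) :
    D ∈ K.treeComponents m ↔ Maximal (fun C => C ⊆ V(K) ∧ IsTreePacked s t m E(K) C) D := by
  simp only [Graph.treeComponents, Set.mem_ofPred_eq, hst.isTreeConnected_induce_iff hm]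

theorem IsOrientation.subset_of_mem_treeComponents (hm : 0 < m) (hst : IsOrientation K s t)
    (hD : D ∈ K.treeComponents m) (hCV : C ⊆ V(K)) (hC : IsTreePacked s t m E(K) C)
    (hxC : x ∈ C) (hxD : x ∈ D) : C ⊆ D := by
  have hmax := (hst.mem_treeComponents_iff hm).1 hD
  exact Set.subset_union_left.trans (hmax.2
    ⟨Set.union_subset hCV hmax.1.1, hC.union hmax.1.2 hxC hxD⟩ Set.subset_union_right)

theorem IsOrientation.eq_of_mem_treeComponents (hm : 0 < m) (hst : IsOrientation K s t)
    (hD : D ∈ K.treeComponents m) (hD' : D' ∈ K.treeComponents m) (hxD : x ∈ D) (hxD' : x ∈ D') :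
    D = D' := by
  obtain ⟨hDV, hDpacked⟩ := ((hst.mem_treeComponents_iff hm).1 hD).1
  obtain ⟨hDV', hDpacked'⟩ := ((hst.mem_treeComponents_iff hm).1 hD').1
  exact (hst.subset_of_mem_treeComponents hm hD' hDV hDpacked hxD hxD').antisymm
    (hst.subset_of_mem_treeComponents hm hD hDV' hDpacked' hxD' hxD)

theorem IsOrientation.exists_mem_treeComponents_superset (hm : 0 < m)
    (hst : IsOrientation K s t) (hV : V(K).Finite) (hCV : C ⊆ V(K))
    (hC : IsTreePacked s t m E(K) C) : ∃ D ∈ K.treeComponents m, C ⊆ D := by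
  have hfin : {D | D ⊆ V(K) ∧ IsTreePacked s t m E(K) D}.Finite :=
    hV.finite_subsets.subset fun D hD => hD.1
  obtain ⟨D, hCD, hD⟩ := hfin.exists_le_maximal (a := C) ⟨hCV, hC⟩
  exact ⟨D, (hst.mem_treeComponents_iff hm).2 hD, hCD⟩

theorem exists_finset_treeComponents (K : Graph α β) (m : ℕ) (hV : V(K).Finite) :
    ∃ P : Finset (Finset α), (∀ D : Finset α, D ∈ P ↔ (D : Set α) ∈ K.treeComponents m) ∧
      P.card = (K.treeComponents m).ncard := by
  have hfin : (K.treeComponents m).Finite := hV.finite_subsets.subset fun D hD => hD.1.1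
  have hpre := hfin.preimage (Finset.coe_injective (α := α)).injOn
  refine ⟨hpre.toFinset, fun D => by simp, ?_⟩
  rw [← Set.ncard_eq_toFinset_card _ hpre, ← Set.ncard_image_of_injective _ Finset.coe_injective,
    Set.image_preimage_eq_of_subset]
  intro D hD
  exact (hV.subset hD.1.1).exists_finset_coe

theorem IsOrientation.card_le_sum_card (hm : 0 < m) (hst : IsOrientation K s t) {W : Finset α}
    (hW : (W : Set α) = V(K)) {P : Finset (Finset α)}
    (hP : ∀ D : Finset α, D ∈ P ↔ (D : Set α) ∈ K.treeComponents m) :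
    W.card ≤ ∑ D ∈ P, D.card := by
  classical
  have hV : V(K).Finite := hW ▸ W.finite_toSet
  refine (Finset.card_le_card fun x hx => ?_).trans (Finset.card_biUnion_le (t := id))
  have hxV : {x} ⊆ V(K) := Set.singleton_subset_iff.2 (hW ▸ hx)
  obtain ⟨D, hD, hxD⟩ :=
    hst.exists_mem_treeComponents_superset hm hV hxV (isTreePacked_singleton hm _ x)
  obtain ⟨D, rfl⟩ := (hV.subset hD.1.1).exists_finset_coe
  exact Finset.mem_biUnion.2 ⟨D, (hP D).2 hD, hxD rfl⟩

theorem IsOrientation.sum_card_edgesIn_add_numCrossing_le (hm : 0 < m)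
    (hst : IsOrientation K s t) {P : Finset (Finset α)}
    (hP : ∀ D ∈ P, (D : Set α) ∈ K.treeComponents m) {F : Finset β}
    (hF : ∀ e ∈ E(K), (∀ D ∈ K.treeComponents m, e ∉ endsIn s t D) → e ∈ F) :
    ∑ D ∈ P, (edgesIn s t F D).card + K.numCrossing (K.treeComponents m) ≤ F.card := by
  classical
  have hinside : (P.biUnion (edgesIn s t F)).card = ∑ D ∈ P, (edgesIn s t F D).card := by
    refine Finset.card_biUnion fun D hD D' hD' hne => Finset.disjoint_left.2 fun e he he' => ?_
    exact hne (Finset.coe_injective (hst.eq_of_mem_treeComponents hm (hP D hD)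
      (hP D' hD') (mem_edgesIn.1 he).2.1 (mem_edgesIn.1 he').2.1))
  have hcross : K.numCrossing (K.treeComponents m) ≤
      (F \ P.biUnion (edgesIn s t F)).card := by
    rw [← Set.ncard_coe_finset]
    refine Set.ncard_le_ncard ?_ (Finset.finite_toSet _)
    rintro e ⟨x, y, hxy, A, hA, B, hB, hAB, hxA, hyB⟩
    have hnot : ∀ D ∈ K.treeComponents m, e ∉ endsIn s t D := by
      intro D hD heD
      have hxyD : x ∈ D ∧ y ∈ D := by
        rcases hxy.eq_and_eq_or_eq_and_eq (hst e hxy.edge_mem) with ⟨rfl, rfl⟩ | ⟨rfl, rfl⟩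
        exacts [heD, heD.symm]
      exact hAB ((hst.eq_of_mem_treeComponents hm hA hD hxA hxyD.1).trans
        (hst.eq_of_mem_treeComponents hm hD hB hxyD.2 hyB))
    refine Finset.mem_coe.2 (Finset.mem_sdiff.2 ⟨hF e hxy.edge_mem hnot, fun he => ?_⟩)
    obtain ⟨D, hD, heD⟩ := Finset.mem_biUnion.1 he
    exact hnot D (hP D hD) (mem_edgesIn.1 heD).2
  calc ∑ D ∈ P, (edgesIn s t F D).card + K.numCrossing (K.treeComponents m)
      ≤ (P.biUnion (edgesIn s t F)).card + (F \ P.biUnion (edgesIn s t F)).card :=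
        Nat.add_le_add hinside.ge hcross
    _ = F.card := by
        rw [add_comm, Finset.card_sdiff_add_card_eq_card
          (Finset.biUnion_subset.2 fun D _ => edgesIn_subset F D)]

theorem mul_Omega (hm : 0 < m) (K : Graph α β) :
    m * Graph.Omega m K = m * (K.treeComponents m).ncard - K.numCrossing (K.treeComponents m) := by
  rw [Graph.Omega]
  field_simp

theorem IsOrientation.mul_card_le_mul_Omega_add (hm : 0 < m) (hst : IsOrientation K s t)
    {W : Finset α} {F : Finset β} (hW : (W : Set α) = V(K)) (hF : (F : Set β) ⊆ E(K))
    (hsparse : IsSparse s t m F)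
    (hcover : ∀ e ∈ E(K), e ∉ F → ∃ C ⊆ W, IsTight s t m F C ∧ e ∈ endsIn s t C) :
    (m * W.card : ℝ) ≤ m * Graph.Omega m K + F.card := by
  have hV : V(K).Finite := hW ▸ W.finite_toSet
  have hsubV : ∀ C ⊆ W, (C : Set α) ⊆ V(K) := fun C hC => hW ▸ Finset.coe_subset.2 hC
  obtain ⟨P, hP, hPcard⟩ := exists_finset_treeComponents K m hV
  have htight : ∀ D ∈ P, m * D.card ≤ (edgesIn s t F D).card + m := by
    intro D hD
    have hDcomp := (hP D).1 hD
    refine ((hst.mem_treeComponents_iff hm).1 hDcomp).1.2.mul_card_le hm hsparse ?_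
    intro e he heF heD
    obtain ⟨C, hCW, hC, heC⟩ := hcover e he heF
    exact ⟨C, Finset.coe_subset.1 (hst.subset_of_mem_treeComponents hm hDcomp (hsubV C hCW)
      (hC.isTreePacked hm hsparse hF) heC.1 heD.1), hC, heC⟩
  have hcross : ∀ e ∈ E(K), (∀ D ∈ K.treeComponents m, e ∉ endsIn s t D) → e ∈ F := by
    intro e he hnot
    by_contra heF
    obtain ⟨C, hCW, hC, heC⟩ := hcover e he heF
    obtain ⟨D, hD, hCD⟩ := hst.exists_mem_treeComponents_superset hm hV (hsubV C hCW)
      (hC.isTreePacked hm hsparse hF)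
    exact hnot D hD ⟨hCD heC.1, hCD heC.2⟩
  have hedges := hst.sum_card_edgesIn_add_numCrossing_le hm (fun D => (hP D).1) hcross
  have hcount : m * W.card + K.numCrossing (K.treeComponents m) ≤
      m * (K.treeComponents m).ncard + F.card := by
    calc m * W.card + K.numCrossing (K.treeComponents m)
        ≤ ∑ D ∈ P, m * D.card + K.numCrossing (K.treeComponents m) := by
          rw [← Finset.mul_sum]
          gcongr
          exact hst.card_le_sum_card hm hW hP
      _ ≤ ∑ D ∈ P, ((edgesIn s t F D).card + m) + K.numCrossing (K.treeComponents m) := by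
          gcongr with D hD
          exact htight D hD
      _ ≤ m * (K.treeComponents m).ncard + F.card := by
          rw [Finset.sum_add_distrib, Finset.sum_const, smul_eq_mul, hPcard, mul_comm m]
          omega
  have hcountR : (m * W.card + K.numCrossing (K.treeComponents m) : ℝ) ≤
      m * (K.treeComponents m).ncard + F.card := mod_cast hcount
  rw [mul_Omega hm]
  linarith

end TreeComponents

section DegreeBounds

variable {α β : Type*} {G : Graph α β} {s t : β → α} {m : ℕ} {V S : Finset α} {H : Finset β}

theorem IsOrientation.degree_restrict (hst : IsOrientation G s t) (hH : (H : Set β) ⊆ E(G))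
    (v : α) : (G.restrict (H : Set β)).degree v = edgeDegree s t H v := by
  classical
  rw [Graph.degree, edgeDegree, ← Set.ncard_coe_finset]
  congr 1
  ext e
  simp only [Graph.mem_incidenceSet, Graph.restrict_inc, Finset.coe_filter, Set.mem_ofPred_eq,
    Finset.mem_coe]
  constructor
  · rintro ⟨he, heH⟩
    exact ⟨heH, (he.eq_or_eq_of_isLink (hst e (hH heH))).imp Eq.symm Eq.symm⟩
  · rintro ⟨heH, rfl | rfl⟩
    exacts [⟨(hst e (hH heH)).inc_left, heH⟩, ⟨(hst e (hH heH)).inc_right, heH⟩]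

theorem IsTreeBase.isTreeConnected_restrict (hm : 0 < m) (hst : IsOrientation G s t)
    (hV : (V : Set α) = V(G)) (hVne : V.Nonempty) (hH : IsTreeBase s t m V E(G) H) :
    (G.restrict (H : Set β)).IsTreeConnected m := by
  have htight : IsTight s t m H V := hH.isTight (hV ▸ hst.subset_endsIn) hVne
  refine isTreeConnected_of_isTreePacked (hst.of_le Graph.restrict_le) ?_
  rw [Graph.vertexSet_restrict, ← hV]
  exact htight.isTreePacked hm hH.sparse fun e he => (⟨hH.subset he, he⟩ : e ∈ E(G) ∩ H)

theorem IsOrientation.card_edgesIn_le_numInside (hst : IsOrientation G s t) (hE : E(G).Finite)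
    (hH : (H : Set β) ⊆ E(G)) : (edgesIn s t H S).card ≤ G.numInside (S : Set α) := by
  rw [Graph.numInside, ← Set.ncard_coe_finset]
  refine Set.ncard_le_ncard (fun e he => ?_) (hE.subset ?_)
  · rw [Finset.mem_coe, mem_edgesIn] at he
    exact ⟨_, _, hst e (hH he.1), he.2⟩
  · rintro e ⟨x, y, hxy, -⟩
    exact hxy.edge_mem

theorem IsTreeBase.mul_card_sdiff_le_mul_Omega_add [DecidableEq α] (hm : 0 < m)
    (hst : IsOrientation G s t) (hV : (V : Set α) = V(G)) (hH : IsTreeBase s t m V E(G) H)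
    (hcover : ∀ e ∈ E(G), e ∉ H → s e ∉ S → t e ∉ S →
      ∃ C ⊆ V, IsTight s t m H C ∧ Disjoint C S ∧ e ∈ endsIn s t C) :
    (m * (V \ S).card : ℝ) ≤
      m * Graph.Omega m (G.deleteVerts S) + (edgesIn s t H (V \ S)).card := by
  have hK : IsOrientation (G.deleteVerts S) s t := hst.of_le Graph.deleteVerts_le
  have hW : ((V \ S : Finset α) : Set α) = V(G.deleteVerts S) := by
    rw [Finset.coe_sdiff, hV, Graph.vertexSet_deleteVerts]
  have hlink : ∀ {e}, e ∈ E(G) → s e ∉ S → t e ∉ S → e ∈ E(G.deleteVerts S) := fun he hs ht =>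
    ((Graph.deleteVerts_isLink ..).2 ⟨hst _ he, hs, ht⟩).edge_mem
  refine hK.mul_card_le_mul_Omega_add hm hW (fun e he => ?_)
    (hH.sparse.mono (edgesIn_subset H _)) fun e he heH => ?_
  · obtain ⟨heH, hs, ht⟩ := mem_edgesIn.1 he
    exact hlink (hH.subset heH) (Finset.mem_sdiff.1 hs).2 (Finset.mem_sdiff.1 ht).2
  · have heVS := hK.subset_endsIn he
    rw [← hW] at heVS
    obtain ⟨C, hCV, hC, hCS, heC⟩ := hcover e (Graph.deleteVerts_le.edgeSet_mono he)
      (fun h => heH (mem_edgesIn.2 ⟨h, heVS⟩)) (Finset.mem_sdiff.1 heVS.1).2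
      (Finset.mem_sdiff.1 heVS.2).2
    have hCVS : C ⊆ V \ S := Finset.subset_sdiff.2 ⟨hCV, hCS⟩
    refine ⟨C, hCVS, hC.congr fun f hf => ?_, heC⟩
    rw [mem_edgesIn]
    exact and_iff_left ⟨hCVS hf.1, hCVS hf.2⟩

theorem IsTreeBase.sum_edgeDegree_le (hm : 0 < m) (hst : IsOrientation G s t)
    (hV : (V : Set α) = V(G)) (hE : E(G).Finite) (hH : IsTreeBase s t m V E(G) H) (hSV : S ⊆ V)
    (hS : S.Nonempty) (hcover : ∀ e ∈ E(G), e ∉ H → s e ∉ S → t e ∉ S →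
      ∃ C ⊆ V, IsTight s t m H C ∧ Disjoint C S ∧ e ∈ endsIn s t C) :
    ∑ v ∈ S, (edgeDegree s t H v : ℝ) ≤ m * Graph.Omega m (G.deleteVerts S) +
      m * (S.card - 1) + min (G.numInside S : ℝ) (m * (S.card - 1)) := by
  classical
  have hdegree : ((edgesIn s t H (V \ S)).card : ℝ) + ∑ v ∈ S, (edgeDegree s t H v : ℝ) ≤
      H.card + (edgesIn s t H S).card :=
    mod_cast card_edgesIn_add_sum_edgeDegree_le (s := s) (t := t) H Finset.disjoint_sdiff
  have hcomponents := hH.mul_card_sdiff_le_mul_Omega_add hm hst hV hcover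
  have hbase : (H.card + m : ℝ) = m * V.card := mod_cast hH.card_eq
  have hsdiff : ((V \ S).card + S.card : ℝ) = V.card :=
    mod_cast Finset.card_sdiff_add_card_eq_card hSV
  have hinside : ((edgesIn s t H S).card : ℝ) ≤ G.numInside S :=
    mod_cast hst.card_edgesIn_le_numInside hE hH.subset
  have hsparse : ((edgesIn s t H S).card + m : ℝ) ≤ m * S.card := mod_cast hH.sparse S hS
  have hmin : ((edgesIn s t H S).card : ℝ) ≤ min (G.numInside S : ℝ) (m * (S.card - 1)) :=
    le_min hinside (by linarith)
  have hvertices : (m * (V \ S).card + m * S.card : ℝ) = m * V.card := by rw [← mul_add, hsdiff]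
  linarith

end DegreeBounds

theorem mul_lt_sum_ceil_sub_add_of_lt {α : Type*} {m : ℕ} (hm : 0 < m) {lam ω e : ℝ}
    (hlam : lam ∈ Set.Icc (0 : ℝ) (1 / (m : ℝ))) {η : α → ℝ} {S : Finset α}
    (hω : ω < 1 / (m : ℝ) + ∑ v ∈ S, (η v - 2) + 2 - lam * (e + m)) :
    m * ω < ∑ v ∈ S, ((⌈(m : ℝ) * η v - (m : ℝ) ^ 2 * lam⌉ : ℝ) - m) + m + 1 -
      min e (m * (S.card - 1)) := by
  have hM : (0 : ℝ) < m := Nat.cast_pos.2 hm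
  have hweight : m * lam ≤ 1 := by
    rw [← mul_one_div_cancel hM.ne']
    exact mul_le_mul_of_nonneg_left hlam.2 hM.le
  have hmin : min e (m * (S.card - 1)) ≤ m * lam * e + (1 - m * lam) * (m * (S.card - 1)) :=
    Convex.min_le_combo _ _ (mul_nonneg hM.le hlam.1) (sub_nonneg.2 hweight) (by ring)
  have hceil : ∑ v ∈ S, ((m : ℝ) * η v - (m : ℝ) ^ 2 * lam - m) ≤
      ∑ v ∈ S, ((⌈(m : ℝ) * η v - (m : ℝ) ^ 2 * lam⌉ : ℝ) - m) :=
    Finset.sum_le_sum fun v _ => sub_le_sub_right (Int.le_ceil _) _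
  calc m * ω < m * (1 / (m : ℝ) + ∑ v ∈ S, (η v - 2) + 2 - lam * (e + m)) := by gcongr
    _ = ∑ v ∈ S, ((m : ℝ) * η v - (m : ℝ) ^ 2 * lam - m) + m + 1 -
        (m * lam * e + (1 - m * lam) * (m * (S.card - 1))) := by
      simp only [Finset.sum_sub_distrib, Finset.sum_const, nsmul_eq_mul, ← Finset.mul_sum]
      field_simp
      ring
    _ ≤ _ := by gcongr

theorem mainTheorem3_general {α β : Type*} (G : Graph α β) (hV : V(G).Finite) (hE : E(G).Finite)
    (m : ℕ) (hm : 0 < m) (hG : G.IsTreeConnected m) (X : Set α) (hX : X ⊆ V(G)) (h : α → ℤ)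
    (hS : ∀ S : Finset α, (S : Set α) ⊆ X → S.Nonempty →
      (m : ℝ) * Graph.Omega m (G.deleteVerts (S : Set α)) <
        ∑ v ∈ S, ((h v : ℝ) - m) + m + 1 -
          min (G.numInside (S : Set α) : ℝ) (m * (S.card - 1))) :
    ∃ H : Graph α β, H.IsSpanningSubgraph G ∧ H.IsTreeConnected m ∧
      ∀ v ∈ X, (H.degree v : ℤ) ≤ h v := by
  have hVne := nonempty_of_isTreeConnected hm hG
  obtain ⟨s, t, hst⟩ := exists_isOrientation hVne
  obtain ⟨V, hVG⟩ := hV.exists_finset_coe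
  have hends : E(G) ⊆ endsIn s t V := hVG ▸ hst.subset_endsIn
  have hpacked : IsTreePacked s t m E(G) V := hVG ▸ isTreePacked_of_isTreeConnected hm hst hG
  obtain ⟨H, hH, hdegree | ⟨S, hSV, hSX, hlt, hcover⟩⟩ :=
    exists_isTreeBase_le_or_saturated hm hends (hpacked.exists_isTreeBase hE) h X
  · refine ⟨G.restrict H, ⟨Graph.restrict_le, rfl⟩,
      hH.isTreeConnected_restrict hm hst hVG hpacked.1, fun v hv => ?_⟩
    rw [hst.degree_restrict hH.subset]
    exact hdegree v (Finset.mem_coe.1 (hVG ▸ hX hv)) hv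
  · have hSne : S.Nonempty := Finset.nonempty_of_ne_empty (by rintro rfl; simp at hlt)
    have hle := hH.sum_edgeDegree_le hm hst hVG hE hSV hSne hcover
    have hbound := hS S hSX hSne
    have hltR : ∑ v ∈ S, (h v : ℝ) + 1 ≤ ∑ v ∈ S, (edgeDegree s t H v : ℝ) := mod_cast hlt
    rw [Finset.sum_sub_distrib, Finset.sum_const, nsmul_eq_mul] at hbound
    linarith

theorem mainTheorem3 {α β : Type*} (G : Graph α β) [G.Loopless]
    (hV : V(G).Finite) (hE : E(G).Finite)
    (m : ℕ) (hm : 0 < m) (hG : G.IsTreeConnected m)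
    (X : Set α) (hX : X ⊆ V(G))
    (lam : ℝ) (hlam : lam ∈ Set.Icc (0 : ℝ) (1 / (m : ℝ)))
    (η : α → ℝ) (hη : ∀ v ∈ X, (m : ℝ) * lam + ((m : ℝ) - 1) / (m : ℝ) < η v)
    (hS : ∀ S : Finset α, (S : Set α) ⊆ X →
      Graph.Omega m (G.deleteVerts (S : Set α)) <
        1 / (m : ℝ) + ∑ v ∈ S, (η v - 2) + 2
          - lam * ((G.numInside (S : Set α) : ℝ) + (m : ℝ))) :
    ∃ H : Graph α β, H.IsSpanningSubgraph G ∧ H.IsTreeConnected m ∧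
      ∀ v ∈ X, (H.degree v : ℤ) ≤ ⌈(m : ℝ) * η v - (m : ℝ) ^ 2 * lam⌉ :=
  mainTheorem3_general G hV hE m hm hG X hX _ fun S hSX _ =>
    mul_lt_sum_ceil_sub_add_of_lt hm hlam (hS S hSX)
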